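/- There is an absolute constant $c>0$ such that the following holds. Let $D>0$, $G>0$, $\mathfrak p\in(1,2]$, $0<\sigma_{\mathfrak s}\le\sigma_{\mathfrak l}$, let $T\ge 1$ be an integer and let $d$ be an integer with $d\ge d_{\mathrm{eff}}:=\sigma_{\mathfrak l}^2/\sigma_{\mathfrak s}^2$. Let $\mathfrak f_G$ be the set of convex $G$-Lipschitz functions $f:\mathbb R^d\to\mathbb R$ (with respect to the Euclidean norm), and let $\mathfrak F_{D,G}$ be the set of those $F\in\mathfrak f_G$ with $\inf_{x_\star\in\operatorname{argmin}F}\|x_\star\|\le D$ (the infimum over the empty set being $+\infty$). A stochastic first-order oracle $\mathbf g\in\mathfrak G$ is a random map which, queried at $x\in\mathbb R^d$ for $f\in\mathfrak f_G$, returns a random vector $\mathbf g(x,f)\in\mathbb R^d$ whose law depends only on $(x,f)$, measurably on $x$, and such that for all $x\in\mathbb R^d$, $f\in\mathfrak f_G$, \[ \nabla f(x):=\mathbb E[\mathbf g(x,f)]\in\partial f(x),\qquad \mathbb E\big[|\langle e,\mathbf g(x,f)-\nabla f(x)\rangle|^{\mathfrak p}\big]\le\sigma_{\mathfrak s}^{\mathfrak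 p}\ \ \text{for all } e \text{ with } \|e\|=1,\qquad \mathbb E\big[\|\mathbf g(x,f)-\nabla f(x)\|^{\mathfrak p}\big]\le\sigma_{\mathfrak l}^{\mathfrak p}. \] A $T$-step first-order method is a tuple $\mathbf A=(\mathbf A_0,\dots,\mathbf A_T)$ of measurable maps $\mathbf A_t:(\mathbb R^d)^t\to\mathbb R^d$; write $\mathfrak A_T$ for the set of all of them. Run on $F$ with $\mathbf g$, it starts at $x_1=\mathbf A_0$, and for $t=1,\dots,T$ it observes $\mathbf g_t=\mathbf g(x_t,F)$, drawn with fresh randomness given the past, and sets $x_{t+1}=\mathbf A_t(\mathbf g_1,\dots,\mathbf g_t)$. Then \[ \sup_{\mathbf g\in\mathfrak G}\ \inf_{\mathbf A\in\mathfrak A_T}\ \sup_{F\in\mathfrak F_{D,G}}\ \mathbb E\Big[F(x_{T+1})-\inf_{x\in\mathbb R^d}F(x)\Big]\ \ge\ c\,\min\Big\{GD,\ \frac{\sigma_{\mathfrak s}^{2/\mathfrak p-1}\,\sigma_{\mathfrak l}^{2-2/\mathfrak p}\,D}{T^{1-1/\mathfrak p}}\Big\}. \] -/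

import Mathlib

open MeasureTheory ProbabilityTheory
open scoped ENNReal

namespace HeavyTailLB

noncomputable section

/-- The space `ℝ^d` with its Euclidean norm. -/
abbrev E (d : ℕ) : Type := EuclideanSpace ℝ (Fin d)

/-- The convex and `G`-Lipschitz functions on `ℝ^d`. -/
def convexLip (d : ℕ) (G : ℝ) : Set (E d → ℝ) :=
  {f | ConvexOn ℝ Set.univ f ∧ ∀ x y, |f x - f y| ≤ G * ‖x - y‖}

/-- The set of (global) minimizers of `F`. -/
def argminSet {d : ℕ} (F : E d → ℝ) : Set (E d) :=
  {x | ∀ z, F x ≤ F z}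

/-- The convex `G`-Lipschitz functions whose set of minimizers is at distance at most `D` from the
origin. The infimum is taken in `[0, ∞]`, so it is `∞` when there is no minimizer, and such
functions are excluded. -/
def objectiveClass (d : ℕ) (D G : ℝ) : Set (convexLip d G) :=
  {F | (⨅ x ∈ argminSet F.1, ‖x‖ₑ) ≤ ENNReal.ofReal D}

/-- `v` is a subgradient of `f` at `x`. -/
def IsSubgradient {d : ℕ} (f : E d → ℝ) (x v : E d) : Prop :=
  ∀ z, f x + inner ℝ v (z - x) ≤ f z

/-- A stochastic first-order oracle for the convex `G`-Lipschitz functions: a random map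
`g(x, f)`, given by its conditional law `law f x` given the query `x` and the function `f`.
Its mean is a subgradient of `f` at `x`, and its error has `p`-th moment at most `σs ^ p` in every
unit direction and at most `σl ^ p` in norm. -/
structure Oracle (d : ℕ) (G p σs σl : ℝ) where
  law : convexLip d G → Kernel (E d) (E d)
  isMarkov : ∀ f, IsMarkovKernel (law f)
  integrable : ∀ f x, Integrable (fun g : E d => g) (law f x)
  mean_subgradient : ∀ f x, IsSubgradient f.1 x (∫ g, g ∂(law f x))
  directional_moment : ∀ f x (e : E d), ‖e‖ = 1 →
    ∫⁻ g, ENNReal.ofReal (|inner ℝ e (g - ∫ g', g' ∂(law f x))| ^ p) ∂(law f x)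
      ≤ ENNReal.ofReal (σs ^ p)
  norm_moment : ∀ f x,
    ∫⁻ g, ENNReal.ofReal (‖g - ∫ g', g' ∂(law f x)‖ ^ p) ∂(law f x)
      ≤ ENNReal.ofReal (σl ^ p)

/-- A first-order method with `T` iterations: measurable maps `A_0, …, A_T`, where `A_t` maps the
first `t` observed stochastic gradients to the next point. -/
structure Algorithm (d T : ℕ) where
  step : (t : Fin (T + 1)) → (Fin t → E d) → E d
  measurable_step : ∀ t, Measurable (step t)

/-- The joint law of the first `t` stochastic gradients `(g_1, …, g_t)` when the method `A` is run
with an oracle whose answer to a query `x` has law `κ x`. Given `(g_1, …, g_t)`, the next query is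
`A_t (g_1, …, g_t)`, and the answer to it is drawn from `κ` at this point. -/
def historyLaw {d T : ℕ} (κ : Kernel (E d) (E d)) (A : Algorithm d T) :
    (t : ℕ) → t ≤ T → Measure (Fin t → E d)
  | 0, _ => Measure.dirac (fun i => i.elim0)
  | t + 1, ht =>
    ((historyLaw κ A t (Nat.le_of_succ_le ht)) ⊗ₘ
      (κ.comap (A.step ⟨t, by omega⟩) (A.measurable_step ⟨t, by omega⟩))).map
        (fun z => (Fin.snoc z.1 z.2 : Fin (t + 1) → E d))

theorem measurable_snoc {d t : ℕ} :
    Measurable (fun z : (Fin t → E d) × E d => (Fin.snoc z.1 z.2 : Fin (t + 1) → E d)) := by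
  refine measurable_pi_lambda _ fun i => ?_
  refine Fin.lastCases ?_ (fun j => ?_) i
  · simpa using measurable_snd
  · simpa [Function.comp_def] using
      (measurable_pi_apply (X := fun _ : Fin t => E d) j).comp measurable_fst

theorem isProbabilityMeasure_historyLaw {d T : ℕ} (κ : Kernel (E d) (E d)) [IsMarkovKernel κ]
    (A : Algorithm d T) : ∀ (t : ℕ) (ht : t ≤ T), IsProbabilityMeasure (historyLaw κ A t ht)
  | 0, _ => by unfold historyLaw; infer_instance
  | t + 1, ht => by
    have := isProbabilityMeasure_historyLaw κ A t (Nat.le_of_succ_le ht)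
    unfold historyLaw
    exact Measure.isProbabilityMeasure_map measurable_snoc.aemeasurable

/-- The expected error `𝔼[F(x_{T+1}) - inf F]` of the output `x_{T+1} = A_T (g_1, …, g_T)` of the
method `A` run on `F` with the oracle `O`. -/
def expectedError {d T : ℕ} {G p σs σl : ℝ} (O : Oracle d G p σs σl) (A : Algorithm d T)
    (F : convexLip d G) : ℝ≥0∞ :=
  ∫⁻ h, ENNReal.ofReal (F.1 (A.step (Fin.last T) h) - ⨅ x, F.1 x)
    ∂(historyLaw (O.law F) A T le_rfl)

/-- The minimax in-expectation error: supremum over oracles, infimum over `T`-step methods, supremum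
over objectives. -/
def minimaxRisk (d T : ℕ) (D G p σs σl : ℝ) : ℝ≥0∞ :=
  ⨆ O : Oracle d G p σs σl, ⨅ A : Algorithm d T, ⨆ F ∈ objectiveClass d D G, expectedError O A F

end

end HeavyTailLB

/-! The hard objectives are scaled `ℓ¹` distances `a q ∑_{i ∈ K} |x i - η s i|` to an unknown sign
vector, on `k = ⌊σl² / σs²⌋` coordinates. For them the oracle reveals each coordinate of a sign
subgradient independently with probability `q`, scaled by `a`, and sends `0` otherwise, so the mean
is a subgradient. Coordinate `i` of an answer depends on the unknown signs only through the `i`-th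
one, and only when it is revealed.

With `q = 1 / (2T)`, a coordinate stays hidden for all `T` answers with probability `(1 - q)^T ≥
1/2`. On that event the objectives that differ only in sign `i` are indistinguishable, and their
losses in coordinate `i` add up to at least `2 a q η`. Averaging over all sign vectors bounds the
worst error below by `k a q η / 2` (`le_coordLoss_add_flipAt`, `le_of_forall_sum_coordLoss_le`).

What remains is how large `a` may be. The single condition `a q √k ≤ σs (k q)^(1 - 1/p) / 8` gives
both moment bounds (`sum_inner_sub_mean_rpow_le`, `sum_norm_sparseVec_sub_mean_rpow_le`): by `p`-th
moments of sparse vectors when `k q ≤ 1`, by variances and Jensen when `k q ≥ 1`. Since `a q √k` is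
also a Lipschitz constant, taking it to be the smaller of `G` and this bound, with `η = D / √k`,
gives the rate.

An oracle must answer for every objective in the class. Outside the hard family it returns a
subgradient without noise, which requires a measurable selection (`exists_measurable_subgradient`).
-/

namespace HeavyTailLB

/-! ### Measurable selection of subgradients by iterated directional derivatives -/

section MeasurableSubgradient

open Set Filter Topology

section Subgradient

variable {V : Type*} [AddCommGroup V] [Module ℝ V]

/-- The one-sided directional derivative of `f` at `x` in direction `y`. -/
noncomputable def dirDeriv (f : V → ℝ) (x y : V) : ℝ :=
  derivWithin (fun t : ℝ => f (x + t • y)) (Ioi 0) 0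

/-- Subadditive and positively homogeneous functions. -/
structure IsSublinear (h : V → ℝ) : Prop where
  add_le : ∀ x y, h (x + y) ≤ h x + h y
  map_smul : ∀ t : ℝ, 0 < t → ∀ x, h (t • x) = t * h x

theorem IsSublinear.convexOn {h : V → ℝ} (hh : IsSublinear h) : ConvexOn ℝ univ h := by
  refine ⟨convex_univ, fun x _ y _ a b ha hb hab => ?_⟩
  rcases ha.eq_or_lt with rfl | ha
  · obtain rfl : b = 1 := by linarith
    simp
  rcases hb.eq_or_lt with rfl | hb
  · obtain rfl : a = 1 := by linarith
    simp
  simpa [hh.map_smul a ha, hh.map_smul b hb] using hh.add_le (a • x) (b • y)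

theorem IsSublinear.map_zero {h : V → ℝ} (hh : IsSublinear h) : h 0 = 0 := by
  have := hh.map_smul 2 two_pos 0
  rw [smul_zero] at this
  linarith

theorem IsSublinear.nonneg_add_neg {h : V → ℝ} (hh : IsSublinear h) (y : V) :
    0 ≤ h y + h (-y) := by
  simpa [hh.map_zero] using hh.add_le y (-y)

theorem convexOn_line {f : V → ℝ} (hf : ConvexOn ℝ univ f) (x y : V) :
    ConvexOn ℝ univ (fun t : ℝ => f (x + t • y)) := by
  refine ⟨convex_univ, fun s _ t _ a b ha hb hab => ?_⟩
  have := hf.2 (mem_univ (x + s • y)) (mem_univ (x + t • y)) ha hb hab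
  have hx : x + (a • s + b • t) • y = a • (x + s • y) + b • (x + t • y) := by
    obtain rfl : b = 1 - a := by linarith
    simp only [smul_eq_mul]
    module
  simpa only [hx] using this

theorem tendsto_dirDeriv {f : V → ℝ} (hf : ConvexOn ℝ univ f) (x y : V) :
    Tendsto (fun t : ℝ => t⁻¹ * (f (x + t • y) - f x)) (𝓝[>] 0) (𝓝 (dirDeriv f x y)) := by
  have h := (convexOn_line hf x y).hasDerivWithinAt_rightDeriv_of_mem_interior (x := 0) (by simp)
  rw [hasDerivWithinAt_iff_tendsto_slope' (by simp)] at h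
  refine h.congr fun t => ?_
  simp [slope_def_field, div_eq_inv_mul]

theorem dirDeriv_le {f : V → ℝ} (hf : ConvexOn ℝ univ f) (x y : V) :
    dirDeriv f x y ≤ f (x + y) - f x := by
  have h := (convexOn_line hf x y).rightDeriv_le_slope_of_mem_interior (x := 0) (y := 1)
    (by simp) (by simp) one_pos
  simpa [slope_def_field, dirDeriv] using h

theorem tendsto_const_mul_nhdsGT_zero {c : ℝ} (hc : 0 < c) :
    Tendsto (fun t : ℝ => c * t) (𝓝[>] 0) (𝓝[>] 0) := by
  refine tendsto_nhdsWithin_iff.2 ⟨?_, ?_⟩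
  · have : Tendsto (fun t : ℝ => c * t) (𝓝 0) (𝓝 (c * 0)) := tendsto_id.const_mul c
    rw [mul_zero] at this
    exact this.mono_left nhdsWithin_le_nhds
  · filter_upwards [self_mem_nhdsWithin] with t ht using mul_pos hc ht

theorem isSublinear_dirDeriv {f : V → ℝ} (hf : ConvexOn ℝ univ f) (x : V) :
    IsSublinear (dirDeriv f x) := by
  refine ⟨fun y z => ?_, fun c hc y => ?_⟩
  -- Step `2t` along `y` and along `z`: the midpoint of the two points is `x + t • (y + z)`, where
  -- convexity applies.
  · have h2 := tendsto_const_mul_nhdsGT_zero (two_pos (α := ℝ))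
    refine le_of_tendsto_of_tendsto (tendsto_dirDeriv hf x (y + z))
      (((tendsto_dirDeriv hf x y).comp h2).add ((tendsto_dirDeriv hf x z).comp h2)) ?_
    filter_upwards [self_mem_nhdsWithin] with t ht
    have ht : 0 < t := ht
    have := hf.2 (mem_univ (x + (2 * t) • y)) (mem_univ (x + (2 * t) • z))
      (by norm_num : (0 : ℝ) ≤ 1 / 2) (by norm_num : (0 : ℝ) ≤ 1 / 2) (by norm_num)
    rw [show (1 / 2 : ℝ) • (x + (2 * t) • y) + (1 / 2 : ℝ) • (x + (2 * t) • z)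
      = x + t • (y + z) by module] at this
    simp only [Function.comp_apply, smul_eq_mul] at this ⊢
    rw [← mul_add, inv_mul_le_iff₀ ht, mul_inv]
    have e : t * (2⁻¹ * t⁻¹ * (f (x + (2 * t) • y) - f x + (f (x + (2 * t) • z) - f x)))
        = 1 / 2 * f (x + (2 * t) • y) + 1 / 2 * f (x + (2 * t) • z) - f x := by
      field_simp
      ring
    rw [e]
    linarith
  · refine tendsto_nhds_unique (tendsto_dirDeriv hf x (c • y)) ?_
    refine (((tendsto_dirDeriv hf x y).comp (tendsto_const_mul_nhdsGT_zero hc)).const_mul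
      c).congr' ?_
    filter_upwards [self_mem_nhdsWithin] with t ht
    have ht : 0 < t := ht
    simp only [Function.comp_apply]
    rw [show (c * t) • y = t • c • y by module]
    field_simp

/-- Homogeneity makes `h` linear along the ray through `e`, so the derivatives at `e` along `e` and
`-e` are at most `h e` and `-h e`. -/
theorem dirDeriv_self_add_neg_le {h : V → ℝ} (hh : IsSublinear h) (e : V) :
    dirDeriv h e e + dirDeriv h e (-e) ≤ 0 := by
  have h1 := dirDeriv_le hh.convexOn e e
  have h2 := dirDeriv_le hh.convexOn e (-e)
  have h3 := hh.map_smul 2 two_pos e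
  rw [two_smul] at h3
  rw [add_neg_cancel, hh.map_zero] at h2
  linarith

/-- Iterated directional derivatives of `h` along a list of vectors. -/
noncomputable def iterDirDeriv (h : V → ℝ) : List V → V → ℝ
  | [] => h
  | e :: L => dirDeriv (iterDirDeriv h L) e

theorem isSublinear_iterDirDeriv {h : V → ℝ} (hh : IsSublinear h) :
    ∀ L : List V, IsSublinear (iterDirDeriv h L)
  | [] => hh
  | e :: L => isSublinear_dirDeriv (isSublinear_iterDirDeriv hh L).convexOn e

theorem iterDirDeriv_cons_le {h : V → ℝ} (hh : IsSublinear h) (e : V) (L : List V) (y : V) :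
    iterDirDeriv h (e :: L) y ≤ iterDirDeriv h L y := by
  have hL := isSublinear_iterDirDeriv hh L
  have h1 := dirDeriv_le hL.convexOn e y
  have h2 := hL.add_le e y
  change dirDeriv _ e y ≤ _
  linarith

theorem iterDirDeriv_le {h : V → ℝ} (hh : IsSublinear h) (y : V) :
    ∀ L : List V, iterDirDeriv h L y ≤ h y
  | [] => le_rfl
  | e :: L => (iterDirDeriv_cons_le hh e L y).trans (iterDirDeriv_le hh y L)

/-- Differentiating at `e` makes the function odd along `e`. Later derivatives only decrease values,
so `h e + h (-e) ≤ 0` persists, and subadditivity gives the reverse inequality. -/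
theorem iterDirDeriv_neg {h : V → ℝ} (hh : IsSublinear h) :
    ∀ (L : List V), ∀ e ∈ L, iterDirDeriv h L (-e) = -iterDirDeriv h L e := by
  intro L
  suffices H : ∀ e ∈ L, iterDirDeriv h L e + iterDirDeriv h L (-e) ≤ 0 by
    intro e he
    have h1 := H e he
    have h2 := (isSublinear_iterDirDeriv hh L).nonneg_add_neg e
    linarith
  induction L with
  | nil => simp
  | cons b L ih =>
    intro e he
    rcases List.mem_cons.1 he with rfl | he
    · exact dirDeriv_self_add_neg_le (isSublinear_iterDirDeriv hh L) e
    · have h1 := iterDirDeriv_cons_le hh b L e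
      have h2 := iterDirDeriv_cons_le hh b L (-e)
      have h3 := ih e he
      linarith

theorem IsSublinear.sum_le {h : V → ℝ} (hh : IsSublinear h) {ι : Type*} (s : Finset ι)
    (y : ι → V) : h (∑ i ∈ s, y i) ≤ ∑ i ∈ s, h (y i) := by
  classical
  induction s using Finset.induction_on with
  | empty => simp [hh.map_zero]
  | insert i s hi ih =>
    rw [Finset.sum_insert hi, Finset.sum_insert hi]
    exact (hh.add_le _ _).trans (by linarith)

theorem IsSublinear.map_smul_of_neg_eq {h : V → ℝ} (hh : IsSublinear h) {e : V}
    (he : h (-e) = -h e) (t : ℝ) : h (t • e) = t * h e := by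
  rcases lt_trichotomy t 0 with ht | rfl | ht
  · rw [show t • e = (-t) • (-e) by module, hh.map_smul _ (by linarith), he]
    ring
  · simp [hh.map_zero]
  · exact hh.map_smul t ht e

end Subgradient

variable {d : ℕ}

theorem measurable_dirDeriv {h : E d → E d → ℝ} (hm : ∀ y, Measurable fun x => h x y)
    (hh : ∀ x, ConvexOn ℝ univ (h x)) (e y : E d) :
    Measurable fun x => dirDeriv (h x) e y := by
  have hlim : Tendsto (fun n : ℕ => 1 / ((n : ℝ) + 1)) atTop (𝓝[>] 0) :=
    tendsto_nhdsWithin_iff.2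
      ⟨tendsto_one_div_add_atTop_nhds_zero_nat, .of_forall fun n => by
        simp only [mem_Ioi]; positivity⟩
  refine measurable_of_tendsto_metrizable (f := fun (n : ℕ) x =>
    (1 / ((n : ℝ) + 1))⁻¹ * (h x (e + (1 / ((n : ℝ) + 1)) • y) - h x e)) (fun n => ?_) ?_
  · exact ((hm _).sub (hm _)).const_mul _
  · exact tendsto_pi_nhds.2 fun x => (tendsto_dirDeriv (hh x) e y).comp hlim

theorem measurable_iterDirDeriv {h : E d → E d → ℝ} (hm : ∀ y, Measurable fun x => h x y)
    (hh : ∀ x, IsSublinear (h x)) :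
    ∀ (L : List (E d)) (y : E d), Measurable fun x => iterDirDeriv (h x) L y
  | [], y => hm y
  | e :: L, y => measurable_dirDeriv (measurable_iterDirDeriv hm hh L)
      (fun x => (isSublinear_iterDirDeriv (hh x) L).convexOn) e y

/-- A continuous convex function on `ℝ^d` has a measurable selection of subgradients. -/
theorem exists_measurable_subgradient {f : E d → ℝ} (hf : ConvexOn ℝ univ f)
    (hc : Continuous f) : ∃ v : E d → E d, Measurable v ∧ ∀ x, IsSubgradient f x (v x) := by
  let b : Fin d → E d := fun i => EuclideanSpace.single i 1
  let L : List (E d) := (List.finRange d).map b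
  let h : E d → E d → ℝ := fun x => dirDeriv f x
  have hh : ∀ x, IsSublinear (h x) := isSublinear_dirDeriv hf
  have hm : ∀ y, Measurable fun x => h x y := by
    intro y
    -- `measurable_dirDeriv` wants a fixed base point, so the dependence on `x` is moved into a
    -- translate of `f`.
    have : (fun x => h x y) = fun x => dirDeriv (fun z => f (x + z)) 0 y := by
      ext x
      simp [h, dirDeriv]
    rw [this]
    refine measurable_dirDeriv (fun z => (hc.comp (by fun_prop)).measurable) (fun x => ?_) 0 y
    simpa [Function.comp_def] using hf.translate_right x
  refine ⟨fun x => WithLp.toLp 2 fun i => iterDirDeriv (h x) L (b i), ?_, fun x z => ?_⟩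
  · exact (WithLp.measurable_toLp 2 _).comp
      (measurable_pi_lambda _ fun i => measurable_iterDirDeriv hm hh L (b i))
  · have hs := isSublinear_iterDirDeriv (hh x) L
    -- Oddness on the basis gives homogeneity for all real factors there. Subadditivity for `-y`,
    -- with `h y + h (-y) ≥ 0`, then puts the linear form below `h`.
    have key : ∀ y : E d, ∑ i, y i * iterDirDeriv (h x) L (b i) ≤ iterDirDeriv (h x) L y := by
      intro y
      have h1 : -y = ∑ i, (-y i) • b i := by
        ext j
        simp [b, Finset.sum_apply, Pi.single_apply]
      have h2 := hs.sum_le Finset.univ fun i => (-y i) • b i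
      rw [← h1] at h2
      have h3 : ∀ i, iterDirDeriv (h x) L ((-y i) • b i) = -y i * iterDirDeriv (h x) L (b i) :=
        fun i => hs.map_smul_of_neg_eq (iterDirDeriv_neg (hh x) L (b i) (by simp [L])) _
      simp only [h3, neg_mul, Finset.sum_neg_distrib] at h2
      have h4 := hs.nonneg_add_neg y
      linarith
    have h1 := key (z - x)
    have h2 := iterDirDeriv_le (hh x) (z - x) L
    have h3 := dirDeriv_le hf x (z - x)
    rw [add_sub_cancel] at h3
    have h4 : inner ℝ (WithLp.toLp 2 fun i => iterDirDeriv (h x) L (b i)) (z - x)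
        = ∑ i, (z - x) i * iterDirDeriv (h x) L (b i) := by
      simp [PiLp.inner_apply]
    rw [h4]
    change iterDirDeriv (h x) L (z - x) ≤ dirDeriv f x (z - x) at h2
    linarith

end MeasurableSubgradient

/-! ### Moment inequalities for finite weights -/

section FiniteWeights

variable {Ω : Type*} [Fintype Ω] {w : Ω → ℝ}

/-- The constant is `2 · 2`: a factor `2^(p - 1) ≤ 2` from splitting the norm of the difference, and
two equal terms since Jensen bounds `‖m‖ ^ p` by the raw moment. -/
theorem sum_norm_sub_mean_rpow_le {V : Type*} [NormedAddCommGroup V] [NormedSpace ℝ V]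
    (hw : ∀ ω, 0 ≤ w ω) (hw1 : ∑ ω, w ω = 1) {p : ℝ} (hp1 : 1 ≤ p) (hp2 : p ≤ 2) (X : Ω → V) :
    ∑ ω, w ω * ‖X ω - ∑ ω', w ω' • X ω'‖ ^ p ≤ 4 * ∑ ω, w ω * ‖X ω‖ ^ p := by
  set m := ∑ ω', w ω' • X ω' with hm
  set S := ∑ ω, w ω * ‖X ω‖ ^ p with hS
  have hp0 : 0 ≤ p := by linarith
  have hmS : ‖m‖ ^ p ≤ S := by
    refine le_trans ?_ (Real.rpow_arith_mean_le_arith_mean_rpow Finset.univ w (fun ω => ‖X ω‖)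
      (fun ω _ => hw ω) hw1 (fun ω _ => norm_nonneg _) hp1)
    refine Real.rpow_le_rpow (norm_nonneg _) ((norm_sum_le _ _).trans_eq ?_) hp0
    exact Finset.sum_congr rfl fun ω _ => by rw [norm_smul, Real.norm_of_nonneg (hw ω)]
  have h2 : (2 : ℝ) ^ (p - 1) ≤ 2 := by
    simpa using Real.rpow_le_rpow_of_exponent_le one_le_two (by linarith : p - 1 ≤ 1)
  have hpt : ∀ ω, ‖X ω - m‖ ^ p ≤ 2 * (‖X ω‖ ^ p + ‖m‖ ^ p) := by
    intro ω
    refine (Real.rpow_le_rpow (norm_nonneg _) (norm_sub_le _ _) hp0).trans ?_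
    have h := Real.rpow_sum_le_const_mul_sum_rpow_of_nonneg (s := Finset.univ)
      (f := ![‖X ω‖, ‖m‖]) hp1 (by simp [Fin.forall_fin_two])
    simp only [Fin.sum_univ_two, Finset.card_univ, Fintype.card_fin,
      Matrix.cons_val_zero, Matrix.cons_val_one] at h
    refine h.trans (mul_le_mul_of_nonneg_right h2 (by positivity))
  calc ∑ ω, w ω * ‖X ω - m‖ ^ p
      ≤ ∑ ω, w ω * (2 * (‖X ω‖ ^ p + ‖m‖ ^ p)) :=
        Finset.sum_le_sum fun ω _ => mul_le_mul_of_nonneg_left (hpt ω) (hw ω)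
    _ = 2 * (S + (∑ ω, w ω) * ‖m‖ ^ p) := by
        rw [hS, Finset.sum_mul, ← Finset.sum_add_distrib, Finset.mul_sum]
        exact Finset.sum_congr rfl fun ω _ => by ring
    _ ≤ 4 * S := by rw [hw1]; linarith

theorem sum_rpow_le_rpow_sum_sq (hw : ∀ ω, 0 ≤ w ω) (hw1 : ∑ ω, w ω = 1) {p : ℝ} (hp0 : 0 < p)
    (hp2 : p ≤ 2) {X : Ω → ℝ} (hX : ∀ ω, 0 ≤ X ω) :
    ∑ ω, w ω * X ω ^ p ≤ (∑ ω, w ω * X ω ^ 2) ^ (p / 2) := by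
  have h := Real.rpow_arith_mean_le_arith_mean_rpow Finset.univ w (fun ω => X ω ^ p)
    (fun ω _ => hw ω) hw1 (fun ω _ => Real.rpow_nonneg (hX ω) p)
    (p := 2 / p) (by rw [le_div_iff₀ hp0]; linarith)
  have hS : 0 ≤ ∑ ω, w ω * X ω ^ p :=
    Finset.sum_nonneg fun ω _ => mul_nonneg (hw ω) (Real.rpow_nonneg (hX ω) p)
  have h2 := Real.rpow_le_rpow (Real.rpow_nonneg hS _) h (by positivity : 0 ≤ p / 2)
  rw [← Real.rpow_mul hS, div_mul_div_cancel₀' (by positivity), div_self hp0.ne',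
    Real.rpow_one] at h2
  refine h2.trans_eq ?_
  congr 1
  refine Finset.sum_congr rfl fun ω _ => ?_
  rw [← Real.rpow_mul (hX ω), mul_div_cancel₀ _ hp0.ne', Real.rpow_two]

theorem sum_sq_sum_eq {ι : Type*} [DecidableEq ι] (K : Finset ι) (Y : ι → Ω → ℝ)
    (hY : ∀ i j, i ≠ j → ∑ ω, w ω * (Y i ω * Y j ω) = 0) :
    ∑ ω, w ω * (∑ i ∈ K, Y i ω) ^ 2 = ∑ i ∈ K, ∑ ω, w ω * Y i ω ^ 2 := by
  simp_rw [sq, Finset.sum_mul_sum, Finset.mul_sum]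
  rw [Finset.sum_comm]
  refine Finset.sum_congr rfl fun i hi => ?_
  rw [Finset.sum_comm, Finset.sum_eq_single i (fun j _ hj => hY i j hj.symm)
    (fun h => absurd hi h)]

end FiniteWeights

/-! ### Independent Bernoulli variables on the Boolean cube -/

section Cube

variable {ι : Type*} [Fintype ι] [DecidableEq ι]

/-- The product weights of independent Bernoulli variables with parameter `q`. -/
def cubeWeight (q : ℝ) (ω : ι → Bool) : ℝ := ∏ i, if ω i then q else 1 - q

/-- The `0`-`1` value of a Boolean. -/
def bit (b : Bool) : ℝ := if b then 1 else 0

theorem bit_sq (b : Bool) : bit b ^ 2 = bit b := by cases b <;> simp [bit]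

theorem bit_nonneg (b : Bool) : 0 ≤ bit b := by cases b <;> simp [bit]

omit [DecidableEq ι] in
theorem cubeWeight_nonneg {q : ℝ} (h0 : 0 ≤ q) (h1 : q ≤ 1) (ω : ι → Bool) :
    0 ≤ cubeWeight q ω :=
  Finset.prod_nonneg fun i _ => by split_ifs <;> linarith

theorem sum_prod_cube (f : ι → Bool → ℝ) :
    ∑ ω : ι → Bool, ∏ i, f i (ω i) = ∏ i, (f i true + f i false) := by
  have h := Finset.prod_univ_sum (fun _ : ι => (Finset.univ : Finset Bool)) f
  rw [Fintype.piFinset_univ] at h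
  rw [← h]
  simp

theorem sum_cubeWeight_mul_mul (q : ℝ) {i j : ι} (hij : i ≠ j) (φ ψ : Bool → ℝ) :
    ∑ ω : ι → Bool, cubeWeight q ω * (φ (ω i) * ψ (ω j))
      = (q * φ true + (1 - q) * φ false) * (q * ψ true + (1 - q) * ψ false) := by
  have h := sum_prod_cube (ι := ι) fun l b => (if b then q else 1 - q) *
    ((if l = i then φ b else 1) * (if l = j then ψ b else 1))
  have e1 : ∀ ω : ι → Bool, ∏ l, ((if ω l then q else 1 - q) *
      ((if l = i then φ (ω l) else 1) * (if l = j then ψ (ω l) else 1)))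
      = cubeWeight q ω * (φ (ω i) * ψ (ω j)) := by
    intro ω
    rw [Finset.prod_mul_distrib, Finset.prod_mul_distrib, Finset.prod_ite_eq',
      Finset.prod_ite_eq']
    simp [cubeWeight]
  simp only [e1] at h
  rw [h]
  have e2 : ∀ l, ((if true then q else 1 - q) *
      ((if l = i then φ true else 1) * (if l = j then ψ true else 1)) +
      (if false then q else 1 - q) *
      ((if l = i then φ false else 1) * (if l = j then ψ false else 1)))
      = (if l = i then q * φ true + (1 - q) * φ false else 1) *
        (if l = j then q * ψ true + (1 - q) * ψ false else 1) := by
    intro l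
    by_cases h1 : l = i
    · subst h1
      simp [hij]
    · by_cases h2 : l = j
      · subst h2
        simp [h1]
      · simp [h1, h2]
  refine (Finset.prod_congr rfl fun l _ => ?_).trans
    ((Finset.prod_mul_distrib (s := Finset.univ)
      (f := fun l => if l = i then q * φ true + (1 - q) * φ false else 1)
      (g := fun l => if l = j then q * ψ true + (1 - q) * ψ false else 1)).trans ?_)
  · simpa using e2 l
  · rw [Finset.prod_ite_eq', Finset.prod_ite_eq']
    simp

theorem sum_cubeWeight (q : ℝ) : ∑ ω : ι → Bool, cubeWeight q ω = 1 := by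
  have h := sum_prod_cube (ι := ι) fun _ b => if b then q else 1 - q
  simpa [cubeWeight] using h

theorem sum_cubeWeight_mul (q : ℝ) (i : ι) (φ : Bool → ℝ) :
    ∑ ω : ι → Bool, cubeWeight q ω * φ (ω i) = q * φ true + (1 - q) * φ false := by
  have h := sum_prod_cube (ι := ι) fun l b => (if b then q else 1 - q) *
    (if l = i then φ b else 1)
  have e1 : ∀ ω : ι → Bool, ∏ l, ((if ω l then q else 1 - q) *
      (if l = i then φ (ω l) else 1)) = cubeWeight q ω * φ (ω i) := by
    intro ω
    rw [Finset.prod_mul_distrib, Finset.prod_ite_eq']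
    simp [cubeWeight]
  simp only [e1] at h
  rw [h]
  refine (Finset.prod_congr rfl fun l _ => ?_).trans ((Finset.prod_ite_eq' Finset.univ i
      (fun _ => q * φ true + (1 - q) * φ false)).trans (by simp))
  by_cases h1 : l = i <;> simp [h1]

theorem sum_cubeWeight_mul_bit (q : ℝ) (i : ι) :
    ∑ ω : ι → Bool, cubeWeight q ω * bit (ω i) = q := by
  rw [sum_cubeWeight_mul q i bit]
  simp [bit]

end Cube

/-! ### Moments of the sparse random vector -/

section Moments

variable {d : ℕ}

/-- The sparse random vector with entries `a * s i` at the indices `i ∈ K` with `ω i`. -/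
def sparseVec (K : Finset (Fin d)) (a : ℝ) (s : Fin d → ℝ) (ω : Fin d → Bool) : E d :=
  WithLp.toLp 2 fun i => if i ∈ K then a * s i * bit (ω i) else 0

/-- The mean of `sparseVec`. -/
def sparseMean (K : Finset (Fin d)) (a q : ℝ) (s : Fin d → ℝ) : E d :=
  WithLp.toLp 2 fun i => if i ∈ K then a * s i * q else 0

variable {K : Finset (Fin d)} {a q p : ℝ} {s : Fin d → ℝ}

theorem sum_cubeWeight_smul_sparseVec (K : Finset (Fin d)) (a q : ℝ) (s : Fin d → ℝ) :
    ∑ ω, cubeWeight q ω • sparseVec K a s ω = sparseMean K a q s := by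
  ext i
  have h := sum_cubeWeight_mul_bit q i
  by_cases hi : i ∈ K
  · simp only [sparseVec, sparseMean, hi, if_true, WithLp.ofLp_sum, WithLp.ofLp_smul,
      Finset.sum_apply, Pi.smul_apply, smul_eq_mul]
    rw [← h, Finset.mul_sum]
    exact Finset.sum_congr rfl fun ω _ => by rw [h]; ring
  · simp [sparseVec, sparseMean, hi]

theorem inner_sparseVec (e : E d) (ω : Fin d → Bool) :
    inner ℝ e (sparseVec K a s ω) = ∑ i ∈ K, e i * (a * s i) * bit (ω i) := by
  simp [sparseVec, PiLp.inner_apply, ite_mul, Finset.sum_ite_mem]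
  exact Finset.sum_congr rfl fun i _ => by ring

theorem inner_sparseVec_sub_sparseMean (e : E d) (ω : Fin d → Bool) :
    inner ℝ e (sparseVec K a s ω - sparseMean K a q s)
      = ∑ i ∈ K, e i * (a * s i) * (bit (ω i) - q) := by
  rw [inner_sub_right, inner_sparseVec]
  simp [sparseMean, PiLp.inner_apply, ite_mul, Finset.sum_ite_mem]
  rw [← Finset.sum_sub_distrib]
  exact Finset.sum_congr rfl fun i _ => by ring

theorem norm_sq_sparseVec (hs : ∀ i, s i ^ 2 = 1) (ω : Fin d → Bool) :
    ‖sparseVec K a s ω‖ ^ 2 = a ^ 2 * ∑ i ∈ K, bit (ω i) := by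
  rw [EuclideanSpace.norm_sq_eq]
  simp only [sparseVec, Real.norm_eq_abs, sq_abs, ite_pow, mul_pow, hs, bit_sq, mul_one]
  rw [Finset.mul_sum]
  simp [Finset.sum_ite_mem]

theorem norm_sq_sparseVec_sub_sparseMean (hs : ∀ i, s i ^ 2 = 1) (ω : Fin d → Bool) :
    ‖sparseVec K a s ω - sparseMean K a q s‖ ^ 2 = a ^ 2 * ∑ i ∈ K, (bit (ω i) - q) ^ 2 := by
  rw [EuclideanSpace.norm_sq_eq]
  have : ∀ i, ‖(sparseVec K a s ω - sparseMean K a q s) i‖ ^ 2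
      = if i ∈ K then a ^ 2 * (bit (ω i) - q) ^ 2 else 0 := by
    intro i
    by_cases hi : i ∈ K
    · simp only [sparseVec, sparseMean, PiLp.sub_apply, hi, if_true, Real.norm_eq_abs, sq_abs]
      rw [← mul_sub, mul_pow, mul_pow, hs, mul_one]
    · simp [sparseVec, sparseMean, hi]
  simp only [this]
  rw [Finset.mul_sum]
  simp [Finset.sum_ite_mem]

theorem sum_cubeWeight_mul_bit_sub_sq (i : Fin d) :
    ∑ ω : Fin d → Bool, cubeWeight q ω * (bit (ω i) - q) ^ 2 = q * (1 - q) := by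
  rw [sum_cubeWeight_mul q i fun b => (bit b - q) ^ 2]
  simp [bit]
  ring

theorem sum_inner_sub_mean_sq_le (hq0 : 0 ≤ q) (hs : ∀ i, s i ^ 2 = 1) {e : E d} (he : ‖e‖ = 1) :
    ∑ ω, cubeWeight q ω * |inner ℝ e (sparseVec K a s ω - sparseMean K a q s)| ^ 2
      ≤ a ^ 2 * q := by
  simp only [sq_abs, inner_sparseVec_sub_sparseMean]
  rw [sum_sq_sum_eq K (fun i (ω : Fin d → Bool) => e i * (a * s i) * (bit (ω i) - q))]
  · have : ∀ i, ∑ ω : Fin d → Bool, cubeWeight q ω * (e i * (a * s i) * (bit (ω i) - q)) ^ 2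
        = (a ^ 2 * (q * (1 - q))) * e i ^ 2 := by
      intro i
      rw [← sum_cubeWeight_mul_bit_sub_sq (q := q) i, Finset.mul_sum, Finset.sum_mul]
      refine Finset.sum_congr rfl fun ω _ => ?_
      rw [mul_pow, mul_pow, mul_pow, hs]
      ring
    simp only [this, ← Finset.mul_sum]
    have h1 : ∑ i ∈ K, e i ^ 2 ≤ 1 := by
      have := EuclideanSpace.norm_sq_eq e
      simp only [he, Real.norm_eq_abs, sq_abs, one_pow] at this
      rw [this]
      exact Finset.sum_le_sum_of_subset_of_nonneg (Finset.subset_univ K) fun i _ _ => sq_nonneg _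
    have h0 : 0 ≤ ∑ i ∈ K, e i ^ 2 := Finset.sum_nonneg fun i _ => sq_nonneg _
    have h2 : q * (1 - q) ≤ q := by nlinarith
    calc a ^ 2 * (q * (1 - q)) * ∑ i ∈ K, e i ^ 2 ≤ a ^ 2 * q * ∑ i ∈ K, e i ^ 2 := by gcongr
      _ ≤ a ^ 2 * q * 1 := by gcongr
      _ = a ^ 2 * q := mul_one _
  · intro i j hij
    have h := sum_cubeWeight_mul_mul q hij (fun b => e i * (a * s i) * (bit b - q))
      (fun b => e j * (a * s j) * (bit b - q))
    rw [h]
    simp [bit]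
    left
    ring

theorem sum_norm_sub_mean_sq_le (hq0 : 0 ≤ q) (hs : ∀ i, s i ^ 2 = 1) :
    ∑ ω, cubeWeight q ω * ‖sparseVec K a s ω - sparseMean K a q s‖ ^ 2
      ≤ a ^ 2 * q * K.card := by
  simp only [norm_sq_sparseVec_sub_sparseMean hs]
  calc ∑ ω : Fin d → Bool, cubeWeight q ω * (a ^ 2 * ∑ i ∈ K, (bit (ω i) - q) ^ 2)
      = a ^ 2 * ∑ i ∈ K, ∑ ω : Fin d → Bool, cubeWeight q ω * (bit (ω i) - q) ^ 2 := by
        rw [Finset.sum_comm, Finset.mul_sum]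
        refine Finset.sum_congr rfl fun ω _ => ?_
        rw [Finset.mul_sum, Finset.mul_sum, Finset.mul_sum]
        exact Finset.sum_congr rfl fun i _ => by ring
    _ = a ^ 2 * (K.card * (q * (1 - q))) := by
        simp only [sum_cubeWeight_mul_bit_sub_sq, Finset.sum_const, nsmul_eq_mul]
    _ ≤ a ^ 2 * q * K.card := by
        have h2 : q * (1 - q) ≤ q := by nlinarith
        calc _ ≤ a ^ 2 * (K.card * q) := by gcongr
          _ = _ := by ring

/-- Power mean inequality with exponent `2 / p`, using `∑ e i ^ 2 ≤ 1`. -/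
theorem sum_abs_rpow_le_card_rpow (hp0 : 0 < p) (hp2 : p ≤ 2) {e : E d} (he : ‖e‖ = 1) :
    ∑ i ∈ K, |e i| ^ p ≤ (K.card : ℝ) ^ (1 - p / 2) := by
  have hS : 0 ≤ ∑ i ∈ K, |e i| ^ p :=
    Finset.sum_nonneg fun i _ => Real.rpow_nonneg (abs_nonneg _) p
  have h := Real.rpow_sum_le_const_mul_sum_rpow_of_nonneg (s := K) (f := fun i => |e i| ^ p)
    (p := 2 / p) (by rw [le_div_iff₀ hp0]; linarith)
    (fun i _ => Real.rpow_nonneg (abs_nonneg _) p)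
  have h1 : ∑ i ∈ K, (|e i| ^ p) ^ (2 / p) ≤ 1 := by
    have := EuclideanSpace.norm_sq_eq e
    simp only [he, Real.norm_eq_abs, one_pow] at this
    rw [this]
    refine (Finset.sum_le_sum_of_subset_of_nonneg (Finset.subset_univ K)
      fun i _ _ => by positivity).trans_eq (Finset.sum_congr rfl fun i _ => ?_)
    rw [← Real.rpow_mul (abs_nonneg _), mul_div_cancel₀ _ hp0.ne', Real.rpow_two]
  have h2 : (∑ i ∈ K, |e i| ^ p) ^ (2 / p) ≤ (K.card : ℝ) ^ (2 / p - 1) :=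
    h.trans (mul_le_of_le_one_right (by positivity) h1)
  have h3 := Real.rpow_le_rpow (Real.rpow_nonneg hS _) h2 (by positivity : 0 ≤ p / 2)
  rw [← Real.rpow_mul hS, ← Real.rpow_mul (Nat.cast_nonneg _),
    div_mul_div_cancel₀' (by positivity), div_self hp0.ne', Real.rpow_one] at h3
  convert h3 using 2
  field_simp

/-- Replaces a fractional power of the number of revealed coordinates by the number itself, whose
expectation is explicit. Integrality is essential here. -/
theorem natCast_rpow_le_self {r : ℝ} (hr0 : 0 < r) (hr1 : r ≤ 1) (n : ℕ) : (n : ℝ) ^ r ≤ n := by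
  rcases Nat.eq_zero_or_pos n with rfl | hn
  · simp [hr0.ne']
  · simpa using Real.rpow_le_rpow_of_exponent_le (by exact_mod_cast hn : (1 : ℝ) ≤ n) hr1

theorem sum_bit_eq_card (K : Finset (Fin d)) (ω : Fin d → Bool) :
    ∑ i ∈ K, bit (ω i) = ((K.filter fun i => ω i).card : ℝ) := by
  simp [bit]

theorem sum_norm_rpow_le (hp0 : 0 < p) (hp2 : p ≤ 2) (ha : 0 ≤ a) (hq0 : 0 ≤ q) (hq1 : q ≤ 1)
    (hs : ∀ i, s i ^ 2 = 1) :
    ∑ ω, cubeWeight q ω * ‖sparseVec K a s ω‖ ^ p ≤ a ^ p * (K.card * q) := by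
  have hpt : ∀ ω, ‖sparseVec K a s ω‖ ^ p ≤ a ^ p * ∑ i ∈ K, bit (ω i) := by
    intro ω
    have h1 : ‖sparseVec K a s ω‖ ^ p = (‖sparseVec K a s ω‖ ^ 2) ^ (p / 2) := by
      rw [← Real.rpow_two, ← Real.rpow_mul (norm_nonneg _), mul_div_cancel₀ _ two_ne_zero]
    rw [h1, norm_sq_sparseVec hs, Real.mul_rpow (sq_nonneg _)
      (Finset.sum_nonneg fun i _ => bit_nonneg _), ← Real.rpow_two, ← Real.rpow_mul ha,
      mul_div_cancel₀ _ two_ne_zero, sum_bit_eq_card]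
    exact mul_le_mul_of_nonneg_left (natCast_rpow_le_self (by positivity) (by linarith) _)
      (by positivity)
  calc _ ≤ ∑ ω, cubeWeight q ω * (a ^ p * ∑ i ∈ K, bit (ω i)) :=
        Finset.sum_le_sum fun ω _ =>
          mul_le_mul_of_nonneg_left (hpt ω) (cubeWeight_nonneg hq0 hq1 ω)
    _ = a ^ p * ∑ i ∈ K, ∑ ω : Fin d → Bool, cubeWeight q ω * bit (ω i) := by
        rw [Finset.sum_comm, Finset.mul_sum]
        refine Finset.sum_congr rfl fun ω _ => ?_
        rw [Finset.mul_sum, Finset.mul_sum, Finset.mul_sum]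
        exact Finset.sum_congr rfl fun i _ => by ring
    _ = a ^ p * (K.card * q) := by
        simp only [sum_cubeWeight_mul_bit, Finset.sum_const, nsmul_eq_mul]

theorem sum_inner_rpow_le (hp1 : 1 < p) (hp2 : p ≤ 2) (ha : 0 ≤ a) (hq0 : 0 ≤ q) (hq1 : q ≤ 1)
    (hs : ∀ i, s i ^ 2 = 1) (hK : K.card * q ≤ 1) {e : E d} (he : ‖e‖ = 1) :
    ∑ ω, cubeWeight q ω * |inner ℝ e (sparseVec K a s ω)| ^ p
      ≤ a ^ p * (2 * q * (K.card : ℝ) ^ (1 - p / 2)) := by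
  have hsabs : ∀ i, |s i| = 1 := fun i => by
    rcases sq_eq_one_iff.1 (hs i) with h | h <;> simp [h]
  have hpt : ∀ ω, |inner ℝ e (sparseVec K a s ω)| ^ p
      ≤ a ^ p * ∑ i ∈ K, ∑ j ∈ K, |e i| ^ p * (bit (ω i) * bit (ω j)) := by
    intro ω
    have h1 : |inner ℝ e (sparseVec K a s ω)| ≤ a * ∑ i ∈ K.filter fun i => ω i, |e i| := by
      rw [inner_sparseVec, Finset.mul_sum, Finset.sum_filter]
      refine (Finset.abs_sum_le_sum_abs _ _).trans_eq (Finset.sum_congr rfl fun i _ => ?_)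
      rw [abs_mul, abs_mul, abs_mul, hsabs, abs_of_nonneg ha]
      by_cases h : ω i <;> simp [h, bit, mul_comm]
    -- With `N` revealed coordinates this costs `N^(p - 1) ≤ N`; writing `N` as a sum of bits leaves
    -- only pair correlations.
    have h2 := Real.rpow_sum_le_const_mul_sum_rpow (K.filter fun i => ω i) (fun i => e i) hp1.le
    refine (Real.rpow_le_rpow (abs_nonneg _) h1 (by linarith)).trans ?_
    rw [Real.mul_rpow ha (Finset.sum_nonneg fun i _ => abs_nonneg _)]
    refine mul_le_mul_of_nonneg_left (h2.trans ?_) (by positivity)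
    refine (mul_le_mul_of_nonneg_right (natCast_rpow_le_self (r := p - 1) (by linarith)
      (by linarith) _) (by positivity)).trans_eq ?_
    rw [← sum_bit_eq_card, Finset.sum_filter, mul_comm, Finset.sum_mul_sum]
    refine Finset.sum_congr rfl fun i _ => Finset.sum_congr rfl fun j _ => ?_
    by_cases h : ω i <;> simp [h, bit]
  have hE : ∀ i ∈ K, ∑ j ∈ K, ∑ ω : Fin d → Bool, cubeWeight q ω * (bit (ω i) * bit (ω j))
      ≤ 2 * q := by
    intro i hi
    rw [← Finset.add_sum_erase K _ hi]
    have h1 : ∑ ω : Fin d → Bool, cubeWeight q ω * (bit (ω i) * bit (ω i)) = q := by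
      simp only [← sq, bit_sq, sum_cubeWeight_mul_bit]
    have h2 : ∀ j ∈ K.erase i, ∑ ω : Fin d → Bool, cubeWeight q ω * (bit (ω i) * bit (ω j))
        = q * q := fun j hj => by
      rw [sum_cubeWeight_mul_mul q (Finset.ne_of_mem_erase hj).symm]
      simp [bit]
    rw [h1, Finset.sum_congr rfl h2, Finset.sum_const, nsmul_eq_mul]
    have h3 : ((K.erase i).card : ℝ) ≤ K.card := by exact_mod_cast Finset.card_erase_le
    have h4 : ((K.erase i).card : ℝ) * q ≤ 1 := (mul_le_mul_of_nonneg_right h3 hq0).trans hK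
    nlinarith
  calc _ ≤ ∑ ω, cubeWeight q ω * (a ^ p * ∑ i ∈ K, ∑ j ∈ K, |e i| ^ p * (bit (ω i) * bit (ω j))) :=
        Finset.sum_le_sum fun ω _ =>
          mul_le_mul_of_nonneg_left (hpt ω) (cubeWeight_nonneg hq0 hq1 ω)
    _ = a ^ p * ∑ i ∈ K, |e i| ^ p *
          ∑ j ∈ K, ∑ ω : Fin d → Bool, cubeWeight q ω * (bit (ω i) * bit (ω j)) := by
        simp only [Finset.mul_sum]
        rw [Finset.sum_comm]
        refine Finset.sum_congr rfl fun i _ => ?_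
        rw [Finset.sum_comm]
        exact Finset.sum_congr rfl fun j _ => Finset.sum_congr rfl fun ω _ => by ring
    _ ≤ a ^ p * ∑ i ∈ K, |e i| ^ p * (2 * q) := by
        refine mul_le_mul_of_nonneg_left (Finset.sum_le_sum fun i hi => ?_) (by positivity)
        exact mul_le_mul_of_nonneg_left (hE i hi) (by positivity)
    _ ≤ a ^ p * (2 * q * (K.card : ℝ) ^ (1 - p / 2)) := by
        rw [← Finset.sum_mul, mul_comm _ (2 * q)]
        have := sum_abs_rpow_le_card_rpow (K := K) (by linarith) hp2 he
        gcongr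

variable {σs σl : ℝ}

/-- The `p`-th power of the condition on `a`, rescaled by `8 (k q)^(1 - p)`; the constant is
absorbed since `8 ≤ 8 ^ p`. The factor `8` pays for centering (`4`) and pair correlations (`2`). -/
theorem mul_rpow_card_le (hp1 : 1 < p) (ha : 0 ≤ a) (hq0 : 0 < q) (hk : 0 < K.card)
    (hσ : 0 < σs)
    (haσ : a * q * √K.card ≤ σs * (K.card * q) ^ (1 - 1 / p) / 8) :
    8 * (a ^ p * q * (K.card : ℝ) ^ (1 - p / 2)) ≤ σs ^ p := by
  set k : ℝ := (K.card : ℝ) with hkdef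
  have hk0 : 0 < k := by rw [hkdef]; exact_mod_cast hk
  have hp0 : 0 < p := by linarith
  have h1 := Real.rpow_le_rpow (by positivity) haσ hp0.le
  have e1 : (a * q * √k) ^ p = a ^ p * q ^ p * k ^ (p / 2) := by
    rw [Real.mul_rpow (by positivity) (by positivity), Real.mul_rpow ha hq0.le,
      Real.sqrt_eq_rpow, ← Real.rpow_mul hk0.le]
    congr 2
    ring
  have e2 : (σs * (k * q) ^ (1 - 1 / p) / 8) ^ p = σs ^ p * (k ^ (p - 1) * q ^ (p - 1)) / 8 ^ p := by
    rw [Real.div_rpow (by positivity) (by positivity), Real.mul_rpow hσ.le (by positivity),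
      ← Real.rpow_mul (by positivity), sub_mul, one_mul, one_div_mul_cancel hp0.ne',
      Real.mul_rpow hk0.le hq0.le]
  rw [e1, e2] at h1
  have h2 := mul_le_mul_of_nonneg_right h1
    (by positivity : 0 ≤ 8 * (k ^ (1 - p) * q ^ (1 - p)))
  have e3 : a ^ p * q ^ p * k ^ (p / 2) * (8 * (k ^ (1 - p) * q ^ (1 - p)))
      = 8 * (a ^ p * q * k ^ (1 - p / 2)) := by
    have f1 : q ^ p * q ^ (1 - p) = q := by
      rw [← Real.rpow_add hq0, add_sub_cancel, Real.rpow_one]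
    have f2 : k ^ (p / 2) * k ^ (1 - p) = k ^ (1 - p / 2) := by
      rw [← Real.rpow_add hk0]
      congr 1
      ring
    rw [← f2]
    nth_rewrite 3 [← f1]
    ring
  have e4 : σs ^ p * (k ^ (p - 1) * q ^ (p - 1)) / 8 ^ p * (8 * (k ^ (1 - p) * q ^ (1 - p)))
      = σs ^ p * (8 / 8 ^ p) := by
    have f1 : q ^ (p - 1) * q ^ (1 - p) = 1 := by
      rw [← Real.rpow_add hq0]
      simp
    have f2 : k ^ (p - 1) * k ^ (1 - p) = 1 := by
      rw [← Real.rpow_add hk0]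
      simp
    calc _ = σs ^ p * (8 / 8 ^ p) * ((k ^ (p - 1) * k ^ (1 - p)) * (q ^ (p - 1) * q ^ (1 - p))) := by
          ring
      _ = _ := by rw [f1, f2]; ring
  rw [e3, e4] at h2
  refine h2.trans (mul_le_of_le_one_right (by positivity) ?_)
  rw [div_le_one (by positivity)]
  simpa using Real.rpow_le_rpow_of_exponent_le (by norm_num : (1 : ℝ) ≤ 8) hp1.le

/-- For `k q ≥ 1` and `p ≤ 2`, `(k q)^(1 - 1/p) ≤ √(k q)`, so the same condition on `a` controls the
variance. -/
theorem sq_mul_le_sq (hp0 : 0 < p) (hp2 : p ≤ 2) (ha : 0 ≤ a) (hq0 : 0 < q)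
    (hσ : 0 < σs) (hK : 1 ≤ K.card * q)
    (haσ : a * q * √K.card ≤ σs * (K.card * q) ^ (1 - 1 / p) / 8) :
    a ^ 2 * q ≤ σs ^ 2 := by
  set k : ℝ := (K.card : ℝ) with hkdef
  have hk0 : 0 < k := by
    by_contra h
    nlinarith [mul_nonpos_of_nonpos_of_nonneg (not_lt.1 h) hq0.le]
  have h1 : (k * q) ^ (1 - 1 / p) ≤ √(k * q) := by
    rw [Real.sqrt_eq_rpow]
    refine Real.rpow_le_rpow_of_exponent_le hK ?_
    have := one_div_le_one_div_of_le hp0 hp2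
    linarith
  have h2 : a * q * √k ≤ σs * √(k * q) := by
    have : 0 ≤ σs * (k * q) ^ (1 - 1 / p) := by positivity
    have := mul_le_mul_of_nonneg_left h1 hσ.le
    linarith
  have h3 := pow_le_pow_left₀ (by positivity) h2 2
  rw [mul_pow, mul_pow, mul_pow, Real.sq_sqrt hk0.le, Real.sq_sqrt (by positivity)] at h3
  refine le_of_mul_le_mul_right ?_ (mul_pos hk0 hq0)
  linarith

theorem rpow_two_mul_half {x : ℝ} (hx : 0 ≤ x) (p : ℝ) : (x ^ 2) ^ (p / 2) = x ^ p := by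
  rw [← Real.rpow_two, ← Real.rpow_mul hx, mul_div_cancel₀ _ two_ne_zero]

theorem sum_inner_sub_mean_rpow_le (hp1 : 1 < p) (hp2 : p ≤ 2) (ha : 0 ≤ a) (hq0 : 0 < q)
    (hq1 : q ≤ 1) (hs : ∀ i, s i ^ 2 = 1) (hk : 0 < K.card) (hσ : 0 < σs)
    (haσ : a * q * √K.card ≤ σs * (K.card * q) ^ (1 - 1 / p) / 8) {e : E d} (he : ‖e‖ = 1) :
    ∑ ω, cubeWeight q ω * |inner ℝ e (sparseVec K a s ω - sparseMean K a q s)| ^ p ≤ σs ^ p := by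
  have hp0 : 0 < p := by linarith
  have hw := cubeWeight_nonneg (ι := Fin d) hq0.le hq1
  rcases le_total (K.card * q) 1 with hK | hK
  · have h1 := sum_norm_sub_mean_rpow_le hw (sum_cubeWeight q) hp1.le hp2
      fun ω => inner ℝ e (sparseVec K a s ω)
    have h2 : ∑ ω, cubeWeight q ω • inner ℝ e (sparseVec K a s ω)
        = inner ℝ e (sparseMean K a q s) := by
      rw [← sum_cubeWeight_smul_sparseVec, inner_sum]
      exact Finset.sum_congr rfl fun ω _ => by rw [inner_smul_right, smul_eq_mul]
    simp only [h2, ← inner_sub_right, Real.norm_eq_abs] at h1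
    have h3 := sum_inner_rpow_le (K := K) hp1 hp2 ha hq0.le hq1 hs hK he
    have h4 := mul_rpow_card_le hp1 ha hq0 hk hσ haσ
    linarith
  · refine (sum_rpow_le_rpow_sum_sq hw (sum_cubeWeight q) hp0 hp2 fun ω => abs_nonneg _).trans ?_
    rw [← rpow_two_mul_half hσ.le]
    refine Real.rpow_le_rpow (Finset.sum_nonneg fun ω _ => mul_nonneg (hw ω) (sq_nonneg _))
      ?_ (by positivity)
    exact (sum_inner_sub_mean_sq_le hq0.le hs he).trans (sq_mul_le_sq hp0 hp2 ha hq0 hσ hK haσ)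

theorem sum_norm_sparseVec_sub_mean_rpow_le (hp1 : 1 < p) (hp2 : p ≤ 2) (ha : 0 ≤ a) (hq0 : 0 < q)
    (hq1 : q ≤ 1) (hs : ∀ i, s i ^ 2 = 1) (hk : 0 < K.card) (hσ : 0 < σs) (hl : 0 ≤ σl)
    (hkσ : K.card * σs ^ 2 ≤ σl ^ 2)
    (haσ : a * q * √K.card ≤ σs * (K.card * q) ^ (1 - 1 / p) / 8) :
    ∑ ω, cubeWeight q ω * ‖sparseVec K a s ω - sparseMean K a q s‖ ^ p ≤ σl ^ p := by
  have hp0 : 0 < p := by linarith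
  have hw := cubeWeight_nonneg (ι := Fin d) hq0.le hq1
  have hk0 : (0 : ℝ) < K.card := by exact_mod_cast hk
  rcases le_total (K.card * q) 1 with hK | hK
  · have h1 := sum_norm_sub_mean_rpow_le hw (sum_cubeWeight q) hp1.le hp2 (sparseVec K a s)
    rw [sum_cubeWeight_smul_sparseVec] at h1
    have h3 := sum_norm_rpow_le (K := K) hp0 hp2 ha hq0.le hq1 hs
    have h4 := mul_rpow_card_le hp1 ha hq0 hk hσ haσ
    -- The factor `k^(p/2)` turns the directional bound into the norm bound, since `(k σs²)^(p/2) ≤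
    -- σl ^ p`.
    have h5 := mul_le_mul_of_nonneg_right h4
      (by positivity : 0 ≤ (K.card : ℝ) ^ (p / 2))
    have e1 : (K.card : ℝ) ^ (1 - p / 2) * (K.card : ℝ) ^ (p / 2) = K.card := by
      rw [← Real.rpow_add hk0, sub_add_cancel, Real.rpow_one]
    have e2 : 8 * (a ^ p * q * (K.card : ℝ) ^ (1 - p / 2)) * (K.card : ℝ) ^ (p / 2)
        = 8 * (a ^ p * (K.card * q)) := by
      linear_combination 8 * a ^ p * q * e1
    rw [e2, ← rpow_two_mul_half hσ.le, mul_comm ((σs ^ 2) ^ (p / 2)),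
      ← Real.mul_rpow hk0.le (sq_nonneg _)] at h5
    have h6 := Real.rpow_le_rpow (by positivity) hkσ (by positivity : 0 ≤ p / 2)
    rw [rpow_two_mul_half hl] at h6
    have h7 : 0 ≤ a ^ p * (K.card * q) := by positivity
    linarith
  · refine (sum_rpow_le_rpow_sum_sq hw (sum_cubeWeight q) hp0 hp2 fun ω => norm_nonneg _).trans ?_
    rw [← rpow_two_mul_half hl]
    refine Real.rpow_le_rpow (Finset.sum_nonneg fun ω _ => mul_nonneg (hw ω) (sq_nonneg _))
      ?_ (by positivity)
    have h1 := mul_le_mul_of_nonneg_right (sq_mul_le_sq hp0 hp2 ha hq0 hσ hK haσ) hk0.le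
    exact (sum_norm_sub_mean_sq_le hq0.le hs).trans (by linarith)

end Moments

/-! ### Kernels with finitely many atoms -/

section FiniteKernel

variable {d : ℕ} {Ω : Type*} [Fintype Ω]

/-- The kernel that sends `x` to the finite combination `∑ ω, w ω • δ (g ω x)`. -/
noncomputable def finKernel (w : Ω → ℝ) (g : Ω → E d → E d) (hg : ∀ ω, Measurable (g ω)) :
    Kernel (E d) (E d) where
  toFun x := ∑ ω, ENNReal.ofReal (w ω) • Measure.dirac (g ω x)
  measurable' := by
    refine Measure.measurable_of_measurable_coe _ fun t ht => ?_
    simp only [Measure.coe_finsetSum, Finset.sum_apply, Measure.smul_apply, smul_eq_mul,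
      Measure.dirac_apply' _ ht]
    exact Finset.measurable_sum _ fun ω _ =>
      ((measurable_const.indicator ht).comp (hg ω)).const_mul _

variable {w : Ω → ℝ} {g : Ω → E d → E d} {hg : ∀ ω, Measurable (g ω)}

theorem finKernel_apply (x : E d) :
    finKernel w g hg x = ∑ ω, ENNReal.ofReal (w ω) • Measure.dirac (g ω x) := rfl

theorem finKernel_apply_univ (hw : ∀ ω, 0 ≤ w ω) (x : E d) :
    finKernel w g hg x Set.univ = ENNReal.ofReal (∑ ω, w ω) := by
  simp [finKernel_apply, ENNReal.ofReal_sum_of_nonneg fun ω _ => hw ω]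

instance : IsFiniteKernel (finKernel w g hg) :=
  ⟨∑ ω, ENNReal.ofReal (w ω), by simp [ENNReal.sum_lt_top], fun x => by simp [finKernel_apply]⟩

theorem isMarkovKernel_finKernel (hw : ∀ ω, 0 ≤ w ω) (hw1 : ∑ ω, w ω = 1) :
    IsMarkovKernel (finKernel w g hg) :=
  ⟨fun x => ⟨by rw [finKernel_apply_univ hw, hw1, ENNReal.ofReal_one]⟩⟩

theorem integrable_finKernel (x : E d) : Integrable (fun y : E d => y) (finKernel w g hg x) := by
  rw [finKernel_apply, integrable_finsetSum_measure]
  exact fun ω _ => (integrable_dirac (by simp)).smul_measure ENNReal.ofReal_ne_top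

theorem integral_finKernel (hw : ∀ ω, 0 ≤ w ω) (x : E d) :
    ∫ y, y ∂(finKernel w g hg x) = ∑ ω, w ω • g ω x := by
  rw [finKernel_apply, integral_finsetSum_measure
    fun ω _ => (integrable_dirac (by simp)).smul_measure ENNReal.ofReal_ne_top]
  refine Finset.sum_congr rfl fun ω _ => ?_
  rw [integral_smul_measure, integral_dirac, ENNReal.toReal_ofReal (hw ω)]

theorem lintegral_finKernel (hw : ∀ ω, 0 ≤ w ω) {φ : E d → ℝ} (hφ : ∀ y, 0 ≤ φ y) (x : E d) :
    ∫⁻ y, ENNReal.ofReal (φ y) ∂(finKernel w g hg x)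
      = ENNReal.ofReal (∑ ω, w ω * φ (g ω x)) := by
  rw [finKernel_apply, lintegral_finsetSum_measure,
    ENNReal.ofReal_sum_of_nonneg fun ω _ => mul_nonneg (hw ω) (hφ _)]
  refine Finset.sum_congr rfl fun ω _ => ?_
  rw [lintegral_smul_measure, lintegral_dirac, smul_eq_mul, ENNReal.ofReal_mul (hw ω)]

theorem finKernel_mono {w' : Ω → ℝ} (hw : ∀ ω, w ω ≤ w' ω) (x : E d) :
    finKernel w g hg x ≤ finKernel w' g hg x := by
  refine Measure.le_iff.2 fun t _ => ?_
  simp only [finKernel_apply, Measure.coe_finsetSum, Finset.sum_apply, Measure.smul_apply,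
    smul_eq_mul]
  exact Finset.sum_le_sum fun ω _ => mul_le_mul_left (ENNReal.ofReal_le_ofReal (hw ω)) _

end FiniteKernel

/-! ### The hard objectives and their oracle -/

section HardInstance

variable {d : ℕ} {K : Finset (Fin d)} {η : ℝ}

/-- The sign encoded by a Boolean. -/
def sgn (b : Bool) : ℝ := if b then 1 else -1

theorem sgn_injective : Function.Injective sgn := by
  intro a b
  cases a <;> cases b <;> norm_num [sgn]

theorem abs_sgn (b : Bool) : |sgn b| = 1 := by cases b <;> simp [sgn]

/-- The scaled `ℓ¹` distance on the coordinates in `K` to the vector of signs `v` times `η`. -/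
def hardFun (K : Finset (Fin d)) (c η : ℝ) (v : Fin d → Bool) (x : E d) : ℝ :=
  c * ∑ i ∈ K, |x i - η * sgn (v i)|

/-- The signs of a subgradient of `hardFun`. -/
noncomputable def subgradSign (η : ℝ) (v : Fin d → Bool) (x : E d) (i : Fin d) : ℝ :=
  if η * sgn (v i) ≤ x i then 1 else -1

/-- The minimizer of `hardFun`. -/
def hardMin (K : Finset (Fin d)) (η : ℝ) (v : Fin d → Bool) : E d :=
  WithLp.toLp 2 fun i => if i ∈ K then η * sgn (v i) else 0

theorem subgradSign_sq (v : Fin d → Bool) (x : E d) (i : Fin d) :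
    subgradSign η v x i ^ 2 = 1 := by
  unfold subgradSign
  split_ifs <;> norm_num

theorem hardFun_nonneg {c : ℝ} (hc : 0 ≤ c) (v : Fin d → Bool) (x : E d) :
    0 ≤ hardFun K c η v x :=
  mul_nonneg hc (Finset.sum_nonneg fun _ _ => abs_nonneg _)

theorem hardFun_hardMin {c : ℝ} (v : Fin d → Bool) : hardFun K c η v (hardMin K η v) = 0 := by
  unfold hardFun
  rw [Finset.sum_eq_zero, mul_zero]
  intro i hi
  simp [hardMin, hi]

theorem iInf_hardFun {c : ℝ} (hc : 0 ≤ c) (v : Fin d → Bool) : ⨅ x, hardFun K c η v x = 0 := by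
  refine le_antisymm ?_ (le_ciInf fun x => hardFun_nonneg hc v x)
  rw [← hardFun_hardMin (K := K) (c := c) (η := η) v]
  exact ciInf_le ⟨0, by rintro _ ⟨x, rfl⟩; exact hardFun_nonneg hc v x⟩ _

theorem norm_hardMin (hη : 0 ≤ η) (v : Fin d → Bool) : ‖hardMin K η v‖ = √K.card * η := by
  rw [EuclideanSpace.norm_eq]
  have : ∀ i, ‖hardMin K η v i‖ ^ 2 = if i ∈ K then η ^ 2 else 0 := by
    intro i
    by_cases hi : i ∈ K
    · simp only [hardMin, hi, if_true, Real.norm_eq_abs, abs_mul, abs_sgn, mul_one, sq_abs]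
    · simp [hardMin, hi]
  simp only [this]
  simp [Finset.sum_ite_mem, Real.sqrt_sq hη]

theorem isSubgradient_hardFun {a q : ℝ} (ha : 0 ≤ a) (hq : 0 ≤ q) (v : Fin d → Bool) (x : E d) :
    IsSubgradient (hardFun K (a * q) η v) x (sparseMean K a q (subgradSign η v x)) := by
  intro z
  have h1 : inner ℝ (sparseMean K a q (subgradSign η v x)) (z - x)
      = (a * q) * ∑ i ∈ K, subgradSign η v x i * (z i - x i) := by
    rw [Finset.mul_sum]
    simp [sparseMean, PiLp.inner_apply, mul_ite, Finset.sum_ite_mem]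
    exact Finset.sum_congr rfl fun i _ => by ring
  rw [h1, hardFun, hardFun, ← mul_add, ← Finset.sum_add_distrib]
  refine mul_le_mul_of_nonneg_left (Finset.sum_le_sum fun i _ => ?_) (by positivity)
  unfold subgradSign
  split_ifs with h
  · rw [abs_of_nonneg (by linarith)]
    linarith [le_abs_self (z i - η * sgn (v i))]
  · rw [abs_of_neg (by linarith)]
    linarith [neg_abs_le (z i - η * sgn (v i))]

theorem hardFun_mem_convexLip {c G : ℝ} (hc : 0 ≤ c) (hG : c * √K.card ≤ G)
    (v : Fin d → Bool) : hardFun K c η v ∈ convexLip d G := by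
  have hsum : ∀ y : E d, ∑ i ∈ K, |y i| ≤ √K.card * ‖y‖ := by
    intro y
    have h := Finset.sum_mul_sq_le_sq_mul_sq K (fun _ => (1 : ℝ)) (fun i => |y i|)
    simp only [one_mul, one_pow, Finset.sum_const, nsmul_eq_mul, mul_one, sq_abs] at h
    have h2 : ∑ i ∈ K, y i ^ 2 ≤ ‖y‖ ^ 2 := by
      rw [EuclideanSpace.norm_sq_eq]
      simp only [Real.norm_eq_abs, sq_abs]
      exact Finset.sum_le_sum_of_subset_of_nonneg (Finset.subset_univ K)
        fun i _ _ => sq_nonneg _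
    refine (pow_le_pow_iff_left₀ (Finset.sum_nonneg fun _ _ => abs_nonneg _) (by positivity)
      two_ne_zero).1 ?_
    rw [mul_pow, Real.sq_sqrt (Nat.cast_nonneg _)]
    exact h.trans (by gcongr)
  refine ⟨⟨convex_univ, fun x _ y _ s t hs ht hst => ?_⟩, fun x y => ?_⟩
  · simp only [hardFun, smul_eq_mul]
    have : ∀ i, |(s • x + t • y) i - η * sgn (v i)|
        ≤ s * |x i - η * sgn (v i)| + t * |y i - η * sgn (v i)| := by
      intro i
      have e : (s • x + t • y) i - η * sgn (v i)
          = s * (x i - η * sgn (v i)) + t * (y i - η * sgn (v i)) := by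
        simp only [PiLp.add_apply, PiLp.smul_apply, smul_eq_mul]
        linear_combination (η * sgn (v i)) * hst
      rw [e]
      refine (abs_add_le _ _).trans_eq ?_
      rw [abs_mul, abs_mul, abs_of_nonneg hs, abs_of_nonneg ht]
    calc c * ∑ i ∈ K, |(s • x + t • y) i - η * sgn (v i)|
        ≤ c * ∑ i ∈ K, (s * |x i - η * sgn (v i)| + t * |y i - η * sgn (v i)|) :=
          mul_le_mul_of_nonneg_left (Finset.sum_le_sum fun i _ => this i) hc
      _ = _ := by
          rw [Finset.sum_add_distrib, ← Finset.mul_sum, ← Finset.mul_sum]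
          ring
  · rw [hardFun, hardFun, ← mul_sub, abs_mul, abs_of_nonneg hc, ← Finset.sum_sub_distrib]
    calc c * |∑ i ∈ K, (|x i - η * sgn (v i)| - |y i - η * sgn (v i)|)|
        ≤ c * ∑ i ∈ K, |(x - y) i| := by
          refine mul_le_mul_of_nonneg_left ((Finset.abs_sum_le_sum_abs _ _).trans
            (Finset.sum_le_sum fun i _ => ?_)) hc
          refine (abs_abs_sub_abs_le_abs_sub _ _).trans_eq ?_
          simp
      _ ≤ c * (√K.card * ‖x - y‖) := mul_le_mul_of_nonneg_left (hsum _) hc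
      _ ≤ G * ‖x - y‖ := by
          rw [← mul_assoc]
          exact mul_le_mul_of_nonneg_right hG (norm_nonneg _)

theorem eq_of_hardFun_eq {c : ℝ} (hc : 0 < c) (hη : 0 < η) {v v' : Fin d → Bool}
    (h : hardFun K c η v = hardFun K c η v') : ∀ i ∈ K, v i = v' i := by
  intro i hi
  have h1 : hardFun K c η v' (hardMin K η v) = 0 := by rw [← h, hardFun_hardMin]
  have h2 := (mul_eq_zero.1 h1).resolve_left hc.ne'
  have h3 := (Finset.sum_eq_zero_iff_of_nonneg fun i _ => abs_nonneg _).1 h2 i hi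
  simp only [hardMin, hi, if_true, abs_eq_zero, ← mul_sub, mul_eq_zero, hη.ne', false_or,
    sub_eq_zero] at h3
  exact sgn_injective h3

theorem measurable_sparseVec_subgradSign (K : Finset (Fin d)) (a η : ℝ) (v : Fin d → Bool)
    (ω : Fin d → Bool) : Measurable fun x : E d => sparseVec K a (subgradSign η v x) ω := by
  refine (WithLp.measurable_toLp 2 _).comp (measurable_pi_lambda _ fun i => ?_)
  by_cases hi : i ∈ K
  · simp only [hi, if_true]
    refine (Measurable.const_mul ?_ a).mul_const _
    refine Measurable.ite (measurableSet_le measurable_const ?_) measurable_const measurable_const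
    exact (measurable_pi_apply i).comp (WithLp.measurable_ofLp 2 _)
  · simp [hi]

/-- The law of the stochastic gradients of `hardFun`, with weights `w` on the patterns of
revealed coordinates. -/
noncomputable def hardKernel (w : (Fin d → Bool) → ℝ) (K : Finset (Fin d)) (a η : ℝ)
    (v : Fin d → Bool) : Kernel (E d) (E d) :=
  finKernel w (fun ω x => sparseVec K a (subgradSign η v x) ω)
    (measurable_sparseVec_subgradSign K a η v)

/-- Hidden coordinates do not influence the answer. This serves both to make the oracle well defined
and to show that a hidden sign cannot be detected. -/
theorem hardKernel_congr {w : (Fin d → Bool) → ℝ} {a : ℝ} {v v' : Fin d → Bool}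
    (h : ∀ ω, w ω ≠ 0 → ∀ i ∈ K, ω i → v i = v' i) :
    hardKernel w K a η v = hardKernel w K a η v' := by
  ext1 x
  simp only [hardKernel, finKernel_apply]
  refine Finset.sum_congr rfl fun ω _ => ?_
  by_cases hw : w ω = 0
  · simp [hw]
  congr 2
  ext i
  by_cases hi : i ∈ K
  · by_cases hω : ω i
    · simp [sparseVec, hi, subgradSign, h ω hw i hi hω]
    · simp [sparseVec, hω, bit]
  · simp [sparseVec, hi]

theorem exists_oracle {a q p σs σl G : ℝ} (hp1 : 1 < p) (hp2 : p ≤ 2) (ha : 0 < a)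
    (hq0 : 0 < q) (hq1 : q ≤ 1) (hk : 0 < K.card) (hσ : 0 < σs) (hl : 0 ≤ σl)
    (hkσ : K.card * σs ^ 2 ≤ σl ^ 2)
    (haσ : a * q * √K.card ≤ σs * (K.card * q) ^ (1 - 1 / p) / 8) (hη : 0 < η)
    (F : (Fin d → Bool) → convexLip d G) (hF : ∀ v, (F v).1 = hardFun K (a * q) η v) :
    ∃ O : Oracle d G p σs σl, ∀ v, O.law (F v) = hardKernel (cubeWeight q) K a η v := by
  classical
  have hw := cubeWeight_nonneg (ι := Fin d) hq0.le hq1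
  have hcont : ∀ f : convexLip d G, Continuous f.1 := by
    intro f
    refine (LipschitzWith.of_dist_le_mul (K := G.toNNReal) fun x y => ?_).continuous
    rw [Real.dist_eq, dist_eq_norm]
    exact (f.2.2 x y).trans
      (mul_le_mul_of_nonneg_right (Real.le_coe_toNNReal G) (norm_nonneg _))
  choose u hum hus using fun f : convexLip d G => exists_measurable_subgradient f.2.1 (hcont f)
  -- Sign vectors that agree on `K` give the same objective; the chosen one is immaterial, because
  -- the kernel sees only the signs on `K`.
  let law : convexLip d G → Kernel (E d) (E d) := fun f =>
    if h : ∃ v, F v = f then hardKernel (cubeWeight q) K a η h.choose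
    else Kernel.deterministic (u f) (hum f)
  have hlaw : ∀ v, law (F v) = hardKernel (cubeWeight q) K a η v := by
    intro v
    have h : ∃ v', F v' = F v := ⟨v, rfl⟩
    have hc : F h.choose = F v := h.choose_spec
    simp only [law, h, dif_pos]
    refine hardKernel_congr fun ω _ i hi _ => ?_
    refine eq_of_hardFun_eq (mul_pos ha hq0) hη ?_ i hi
    rw [← hF, ← hF, hc]
  have hcases : ∀ f, (∃ v, F v = f ∧ law f = hardKernel (cubeWeight q) K a η v) ∨
      law f = Kernel.deterministic (u f) (hum f) := by
    intro f
    by_cases h : ∃ v, F v = f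
    · obtain ⟨v, rfl⟩ := h
      exact .inl ⟨v, rfl, hlaw v⟩
    · exact .inr (by simp only [law, h, dif_neg, not_false_eq_true])
  have hmean : ∀ v x, ∫ g, g ∂(hardKernel (cubeWeight q) K a η v x)
      = sparseMean K a q (subgradSign η v x) := fun v x => by
    rw [hardKernel, integral_finKernel hw, sum_cubeWeight_smul_sparseVec]
  have hdet : ∀ f x, ∫ g, g ∂(Kernel.deterministic (u f) (hum f) x) = u f x := fun f x => by
    rw [Kernel.deterministic_apply, integral_dirac]
  have hp0 : p ≠ 0 := by linarith
  refine ⟨⟨law, fun f => ?_, fun f x => ?_, fun f x => ?_, fun f x e he => ?_, fun f x => ?_⟩,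
    hlaw⟩
  · rcases hcases f with ⟨v, -, h⟩ | h <;> rw [h]
    · exact isMarkovKernel_finKernel hw (sum_cubeWeight q)
    · infer_instance
  · rcases hcases f with ⟨v, -, h⟩ | h <;> rw [h]
    · exact integrable_finKernel x
    · rw [Kernel.deterministic_apply]
      exact integrable_dirac (by simp)
  · rcases hcases f with ⟨v, rfl, h⟩ | h <;> rw [h]
    · rw [hmean, hF]
      exact isSubgradient_hardFun ha.le hq0.le v x
    · rw [hdet]
      exact hus f x
  · rcases hcases f with ⟨v, -, h⟩ | h <;> rw [h]
    · rw [hmean, hardKernel, lintegral_finKernel hw (fun y => by positivity)]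
      exact ENNReal.ofReal_le_ofReal (sum_inner_sub_mean_rpow_le hp1 hp2 ha.le hq0 hq1
        (subgradSign_sq v x) hk hσ haσ he)
    · rw [hdet, Kernel.deterministic_apply, lintegral_dirac]
      simp [hp0]
  · rcases hcases f with ⟨v, -, h⟩ | h <;> rw [h]
    · rw [hmean, hardKernel, lintegral_finKernel hw (fun y => by positivity)]
      exact ENNReal.ofReal_le_ofReal (sum_norm_sparseVec_sub_mean_rpow_le hp1 hp2 ha.le hq0 hq1
        (subgradSign_sq v x) hk hσ hl hkσ haσ)
    · rw [hdet, Kernel.deterministic_apply, lintegral_dirac]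
      simp [hp0]

end HardInstance

/-! ### Monotonicity and mass of history laws -/

section History

variable {d T : ℕ} {κ κ' : Kernel (E d) (E d)}

theorem isFiniteMeasure_historyLaw [IsFiniteKernel κ] (A : Algorithm d T) :
    ∀ (t : ℕ) (ht : t ≤ T), IsFiniteMeasure (historyLaw κ A t ht)
  | 0, _ => by unfold historyLaw; infer_instance
  | t + 1, ht => by
    have := isFiniteMeasure_historyLaw A t (Nat.le_of_succ_le ht)
    unfold historyLaw
    infer_instance

/-- Kernels need not be Markov here: discarding the patterns that reveal a coordinate leaves a
sub-probability kernel, whose history law is the part of the true law where that coordinate stays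
hidden. -/
theorem historyLaw_mono [IsFiniteKernel κ] [IsFiniteKernel κ'] (h : ∀ x, κ x ≤ κ' x)
    (A : Algorithm d T) : ∀ (t : ℕ) (ht : t ≤ T), historyLaw κ A t ht ≤ historyLaw κ' A t ht
  | 0, _ => by unfold historyLaw; exact le_rfl
  | t + 1, ht => by
    have ih := historyLaw_mono h A t (Nat.le_of_succ_le ht)
    have := isFiniteMeasure_historyLaw (κ := κ) A t (Nat.le_of_succ_le ht)
    have := isFiniteMeasure_historyLaw (κ := κ') A t (Nat.le_of_succ_le ht)
    unfold historyLaw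
    refine Measure.map_mono (Measure.le_iff.2 fun s hs => ?_) measurable_snoc
    rw [Measure.compProd_apply hs, Measure.compProd_apply hs]
    exact lintegral_mono' ih fun z => h _ _

theorem historyLaw_univ [IsFiniteKernel κ] {m : ℝ≥0∞} (h : ∀ x, κ x Set.univ = m)
    (A : Algorithm d T) : ∀ (t : ℕ) (ht : t ≤ T), historyLaw κ A t ht Set.univ = m ^ t
  | 0, _ => by unfold historyLaw; simp
  | t + 1, ht => by
    have ih := historyLaw_univ h A t (Nat.le_of_succ_le ht)
    have := isFiniteMeasure_historyLaw (κ := κ) A t (Nat.le_of_succ_le ht)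
    unfold historyLaw
    rw [Measure.map_apply measurable_snoc .univ, Set.preimage_univ,
      Measure.compProd_apply .univ]
    simp [Kernel.comap_apply, h, ih, pow_succ, mul_comm]

end History

/-! ### Indistinguishable pairs and averaging over signs -/

section LowerBound

variable {d T : ℕ} {K : Finset (Fin d)} {a q η c : ℝ}

theorem measurable_ofReal_mul_abs_sub {α : Type*} [MeasurableSpace α] {f : α → ℝ}
    (hf : Measurable f) (c r : ℝ) : Measurable fun x => ENNReal.ofReal (c * |f x - r|) := by
  fun_prop

/-- The expected loss in coordinate `i` of the method `A` on `hardFun`. -/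
noncomputable def coordLoss (K : Finset (Fin d)) (a q η c : ℝ) (A : Algorithm d T)
    (i : Fin d) (v : Fin d → Bool) : ℝ≥0∞ :=
  ∫⁻ h, ENNReal.ofReal (c * |A.step (Fin.last T) h i - η * sgn (v i)|)
    ∂(historyLaw (hardKernel (cubeWeight q) K a η v) A T le_rfl)

/-- Negation of the `i`-th entry of a Boolean vector. -/
def flipAt (i : Fin d) (v : Fin d → Bool) : Fin d → Bool := Function.update v i (!v i)

theorem flipAt_involutive (i : Fin d) : Function.Involutive (flipAt i) := by
  intro v
  simp [flipAt]

theorem le_coordLoss_add_flipAt (hq0 : 0 ≤ q) (hq1 : q ≤ 1) (hc : 0 ≤ c)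
    (A : Algorithm d T) (i : Fin d) (v : Fin d → Bool) :
    ENNReal.ofReal (2 * c * η * (1 - q) ^ T)
      ≤ coordLoss K a q η c A i v + coordLoss K a q η c A i (flipAt i v) := by
  have hw := cubeWeight_nonneg (ι := Fin d) hq0 hq1
  -- Only patterns hiding `i` keep their weight. The resulting history law `ν` is common to `v` and
  -- `flipAt i v`, has mass `(1 - q)^T`, and lies below both true laws.
  let w : (Fin d → Bool) → ℝ := fun ω => cubeWeight q ω * (1 - bit (ω i))
  have hbit : ∀ b : Bool, 0 ≤ 1 - bit b := fun b => by cases b <;> simp [bit]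
  have hw0 : ∀ ω, 0 ≤ w ω := fun ω => mul_nonneg (hw ω) (hbit _)
  have hwle : ∀ ω, w ω ≤ cubeWeight q ω := fun ω =>
    mul_le_of_le_one_right (hw ω) (by linarith [bit_nonneg (ω i)])
  have hwsum : ∑ ω, w ω = 1 - q := by
    rw [sum_cubeWeight_mul q i fun b => 1 - bit b]
    simp [bit]
  have hfin : ∀ w' v', IsFiniteKernel (hardKernel w' K a η v') := fun w' v' => by
    unfold hardKernel
    infer_instance
  have hκ : hardKernel w K a η v = hardKernel w K a η (flipAt i v) := by
    refine hardKernel_congr fun ω hω j _ hj => ?_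
    have hji : j ≠ i := by
      rintro rfl
      simp [w, bit, hj] at hω
    simp [flipAt, hji]
  set ν := historyLaw (hardKernel w K a η v) A T le_rfl with hν
  have hle : ∀ v', hardKernel w K a η v' = hardKernel w K a η v →
      ν ≤ historyLaw (hardKernel (cubeWeight q) K a η v') A T le_rfl := fun v' h => by
    rw [hν, ← h]
    exact historyLaw_mono (fun x => finKernel_mono hwle x) A T le_rfl
  have hmass : ν Set.univ = ENNReal.ofReal (1 - q) ^ T :=
    historyLaw_univ (fun x => by rw [hardKernel, finKernel_apply_univ hw0, hwsum]) A T le_rfl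
  have hsgn : sgn (flipAt i v i) = -sgn (v i) := by
    cases h : v i <;> simp [flipAt, sgn, h]
  have hmeas : Measurable fun h : Fin T → E d => A.step (Fin.last T) h i :=
    (measurable_pi_apply i).comp ((WithLp.measurable_ofLp 2 _).comp (A.measurable_step _))
  calc ENNReal.ofReal (2 * c * η * (1 - q) ^ T)
      = ∫⁻ _, ENNReal.ofReal (2 * c * η) ∂ν := by
        rw [lintegral_const, hmass, ← ENNReal.ofReal_pow (by linarith),
          ← ENNReal.ofReal_mul' (pow_nonneg (by linarith) _)]
    _ ≤ ∫⁻ h, (ENNReal.ofReal (c * |A.step (Fin.last T) h i - η * sgn (v i)|) +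
          ENNReal.ofReal (c * |A.step (Fin.last T) h i - η * sgn (flipAt i v i)|)) ∂ν := by
        refine lintegral_mono fun h => ?_
        rw [← ENNReal.ofReal_add (by positivity) (by positivity), hsgn]
        refine ENNReal.ofReal_le_ofReal ?_
        rw [← mul_add, mul_comm 2 c, mul_assoc]
        refine mul_le_mul_of_nonneg_left ?_ hc
        set y := A.step (Fin.last T) h i
        have h1 : |2 * η * sgn (v i)| ≤ |y - η * sgn (v i)| + |y - η * -sgn (v i)| := by
          have := abs_sub (y - η * -sgn (v i)) (y - η * sgn (v i))
          rw [add_comm] at this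
          refine le_trans (le_of_eq ?_) this
          congr 1
          ring
        rw [abs_mul, abs_sgn, mul_one] at h1
        exact (le_abs_self _).trans h1
    _ ≤ _ := by
        rw [lintegral_add_left (measurable_ofReal_mul_abs_sub hmeas c _)]
        unfold coordLoss
        exact add_le_add (lintegral_mono' (hle v rfl) le_rfl)
          (lintegral_mono' (hle _ hκ.symm) le_rfl)

theorem le_of_forall_sum_coordLoss_le (hq0 : 0 ≤ q) (hq1 : q ≤ 1) (hqT : T * q ≤ 1 / 2)
    (hc : 0 ≤ c) (hη : 0 ≤ η) (A : Algorithm d T) {M : ℝ≥0∞}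
    (hM : ∀ v, ∑ i ∈ K, coordLoss K a q η c A i v ≤ M) :
    ENNReal.ofReal (K.card * c * η / 2) ≤ M := by
  -- Bernoulli's inequality with `T q ≤ 1/2`.
  have hpow : 1 / 2 ≤ (1 - q) ^ T := by
    have := one_add_mul_le_pow (a := -q) (by linarith) T
    rw [← sub_eq_add_neg] at this
    linarith
  have hpair : ∀ i v, ENNReal.ofReal (c * η)
      ≤ coordLoss K a q η c A i v + coordLoss K a q η c A i (flipAt i v) := fun i v => by
    refine (ENNReal.ofReal_le_ofReal ?_).trans (le_coordLoss_add_flipAt hq0 hq1 hc A i v)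
    have := mul_le_mul_of_nonneg_left hpow (by positivity : 0 ≤ 2 * c * η)
    linarith
  set N : ℝ≥0∞ := (Fintype.card (Fin d → Bool) : ℝ≥0∞) with hN
  have hN0 : N ≠ 0 := by simp [hN]
  have hNt : N ≠ ⊤ := ENNReal.natCast_ne_top _
  have hsum : ∀ i, N * ENNReal.ofReal (c * η) ≤ 2 * ∑ v, coordLoss K a q η c A i v := by
    intro i
    -- Flipping permutes the sign vectors, so summing the pair bound over all `v` counts every loss
    -- twice.
    have h1 : ∑ v, coordLoss K a q η c A i (flipAt i v) = ∑ v, coordLoss K a q η c A i v :=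
      Equiv.sum_comp (flipAt_involutive i).toPerm fun v => coordLoss K a q η c A i v
    rw [two_mul]
    nth_rewrite 2 [← h1]
    rw [← Finset.sum_add_distrib]
    have := Finset.card_nsmul_le_sum Finset.univ _ _ fun v _ => hpair i v
    simpa [hN] using this
  have h2 : N * ENNReal.ofReal (K.card * c * η) ≤ N * (2 * M) := by
    calc N * ENNReal.ofReal (K.card * c * η)
        = ∑ i ∈ K, N * ENNReal.ofReal (c * η) := by
          rw [Finset.sum_const, nsmul_eq_mul, mul_assoc (K.card : ℝ),
            ENNReal.ofReal_mul (Nat.cast_nonneg _), ENNReal.ofReal_natCast]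
          ring
      _ ≤ ∑ i ∈ K, 2 * ∑ v, coordLoss K a q η c A i v := Finset.sum_le_sum fun i _ => hsum i
      _ = 2 * ∑ v, ∑ i ∈ K, coordLoss K a q η c A i v := by
          rw [← Finset.mul_sum, Finset.sum_comm]
      _ ≤ 2 * ∑ v : Fin d → Bool, M := by
          gcongr with v
          exact hM v
      _ = N * (2 * M) := by
          rw [Finset.sum_const, nsmul_eq_mul, Finset.card_univ]
          ring
  have h3 := (ENNReal.mul_le_mul_iff_right hN0 hNt).1 h2
  rw [ENNReal.ofReal_div_of_pos two_pos, ENNReal.ofReal_ofNat]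
  exact ENNReal.div_le_of_le_mul' h3

theorem hardMin_mem_argminSet (hc : 0 ≤ c) (v : Fin d → Bool) :
    hardMin K η v ∈ argminSet (hardFun K c η v) := fun z => by
  rw [hardFun_hardMin]
  exact hardFun_nonneg hc v z

theorem le_minimaxRisk {D G p σs σl : ℝ} (hp1 : 1 < p) (hp2 : p ≤ 2) (ha : 0 < a)
    (hq0 : 0 < q) (hq1 : q ≤ 1) (hqT : T * q ≤ 1 / 2) (hk : 0 < K.card) (hσ : 0 < σs)
    (hl : 0 ≤ σl) (hkσ : K.card * σs ^ 2 ≤ σl ^ 2)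
    (haσ : a * q * √K.card ≤ σs * (K.card * q) ^ (1 - 1 / p) / 8)
    (haG : a * q * √K.card ≤ G) (hη : 0 < η) (hD : √K.card * η ≤ D) :
    ENNReal.ofReal (K.card * (a * q) * η / 2) ≤ minimaxRisk d T D G p σs σl := by
  have hc : 0 < a * q := mul_pos ha hq0
  let F : (Fin d → Bool) → convexLip d G := fun v =>
    ⟨hardFun K (a * q) η v, hardFun_mem_convexLip hc.le haG v⟩
  obtain ⟨O, hO⟩ := exists_oracle hp1 hp2 ha hq0 hq1 hk hσ hl hkσ haσ hη F fun v => rfl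
  refine le_trans (le_iInf fun A => ?_) (le_iSup (fun O : Oracle d G p σs σl =>
    ⨅ A : Algorithm d T, ⨆ F ∈ objectiveClass d D G, expectedError O A F) O)
  refine le_of_forall_sum_coordLoss_le (a := a) hq0.le hq1 hqT hc.le hη.le A fun v => ?_
  have hmem : F v ∈ objectiveClass d D G := by
    change (⨅ x ∈ argminSet (hardFun K (a * q) η v), ‖x‖ₑ) ≤ ENNReal.ofReal D
    refine iInf₂_le_of_le (hardMin K η v) (hardMin_mem_argminSet hc.le v) ?_
    rw [← ofReal_norm, norm_hardMin hη.le]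
    exact ENNReal.ofReal_le_ofReal hD
  refine le_iSup₂_of_le (F v) hmem ?_
  have hmeas : ∀ i, Measurable fun h : Fin T → E d => A.step (Fin.last T) h i := fun i =>
    (measurable_pi_apply i).comp ((WithLp.measurable_ofLp 2 _).comp (A.measurable_step _))
  simp only [coordLoss, expectedError, hO]
  rw [← lintegral_finsetSum _ fun i _ => measurable_ofReal_mul_abs_sub (hmeas i) _ _]
  refine lintegral_mono fun h => ?_
  change _ ≤ ENNReal.ofReal (hardFun K (a * q) η v _ - ⨅ x, hardFun K (a * q) η v x)
  rw [iInf_hardFun hc.le, sub_zero, hardFun, Finset.mul_sum,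
    ENNReal.ofReal_sum_of_nonneg fun i _ => by positivity]

end LowerBound

/-! ### Choice of parameters and the final rate -/

theorem rate_le {p σs σl k T : ℝ} (hp1 : 1 < p) (hp2 : p ≤ 2) (hσ : 0 < σs) (hl : 0 < σl)
    (hT : 0 < T) (hk : σl ^ 2 / σs ^ 2 ≤ 2 * k) :
    σs ^ (2 / p - 1) * σl ^ (2 - 2 / p) / T ^ (1 - 1 / p)
      ≤ 2 * (σs * (k * (1 / (2 * T))) ^ (1 - 1 / p)) := by
  set r := 1 - 1 / p with hr
  have hr0 : 0 ≤ r := by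
    rw [hr, sub_nonneg, div_le_one (by linarith)]
    exact hp1.le
  have hr2 : r ≤ 1 / 2 := by
    have := one_div_le_one_div_of_le (by linarith) hp2
    rw [hr]
    linarith
  have h4 : (4 : ℝ) ^ r ≤ 2 := by
    calc (4 : ℝ) ^ r ≤ 4 ^ (1 / 2 : ℝ) := Real.rpow_le_rpow_of_exponent_le (by norm_num) hr2
      _ = 2 := by
        rw [← Real.sqrt_eq_rpow, show (4 : ℝ) = 2 ^ 2 by norm_num, Real.sqrt_sq two_pos.le]
  have e1 : σs ^ (2 / p - 1) * σl ^ (2 - 2 / p) = σs * (σl ^ 2 / σs ^ 2) ^ r := by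
    rw [Real.div_rpow (by positivity) (by positivity), ← Real.rpow_two, ← Real.rpow_two,
      ← Real.rpow_mul hl.le, ← Real.rpow_mul hσ.le,
      show 2 / p - 1 = 1 - 2 * r by rw [hr]; ring, show 2 - 2 / p = 2 * r by rw [hr]; ring,
      Real.rpow_sub hσ, Real.rpow_one]
    ring
  -- Rounding `σl² / σs²` down to `k` and taking `q = 1 / (2T)` each lose a factor `2`; the loss is
  -- `4 ^ r ≤ 2` because `r ≤ 1/2`.
  have e2 : (σl ^ 2 / σs ^ 2) ^ r / T ^ r ≤ 2 * (k * (1 / (2 * T))) ^ r := by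
    rw [← Real.div_rpow (by positivity) hT.le]
    have h1 : σl ^ 2 / σs ^ 2 / T ≤ 4 * (k * (1 / (2 * T))) := by
      rw [show 4 * (k * (1 / (2 * T))) = 2 * k / T by field_simp; ring]
      gcongr
    have hk0 : 0 ≤ k * (1 / (2 * T)) := by
      have : 0 ≤ σl ^ 2 / σs ^ 2 / T := by positivity
      linarith
    refine (Real.rpow_le_rpow (by positivity) h1 hr0).trans ?_
    rw [Real.mul_rpow (by norm_num) hk0]
    gcongr
  rw [e1, mul_div_assoc]
  have := mul_le_mul_of_nonneg_left e2 hσ.le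
  linarith

theorem minimaxRisk_lower_bound {D G p σs σl : ℝ} {d T : ℕ} (hD : 0 < D) (hG : 0 < G)
    (hp1 : 1 < p) (hp2 : p ≤ 2) (hσ : 0 < σs) (hσl : σs ≤ σl)
    (hd : σl ^ 2 / σs ^ 2 ≤ (d : ℝ)) (hT : 1 ≤ T) :
    ENNReal.ofReal (1 / 32 * min (G * D)
        (σs ^ (2 / p - 1) * σl ^ (2 - 2 / p) * D / (T : ℝ) ^ (1 - 1 / p)))
      ≤ minimaxRisk d T D G p σs σl := by
  have hl : 0 < σl := hσ.trans_le hσl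
  have hT0 : (0 : ℝ) < T := by exact_mod_cast hT
  have hT1 : (1 : ℝ) ≤ T := by exact_mod_cast hT
  set ρ := σl ^ 2 / σs ^ 2 with hρ
  have hρ1 : 1 ≤ ρ := by
    rw [hρ, one_le_div (by positivity)]
    exact pow_le_pow_left₀ hσ.le hσl 2
  have hkd : ⌊ρ⌋₊ ≤ d := Nat.floor_le_of_le hd
  -- Rounding down gives `k ≤ d` and `k σs² ≤ σl²`; since `ρ ≥ 1`, at most a factor `2` is lost.
  obtain ⟨K, -, hKcard⟩ := Finset.exists_subset_card_eq
    (s := (Finset.univ : Finset (Fin d))) (n := ⌊ρ⌋₊) (by simpa using hkd)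
  have hk1 : 1 ≤ K.card := by rw [hKcard]; exact Nat.le_floor (by simpa using hρ1)
  set k : ℝ := (K.card : ℝ) with hk
  have hk1' : (1 : ℝ) ≤ k := by rw [hk]; exact_mod_cast hk1
  have hkρ : k ≤ ρ := by rw [hk, hKcard]; exact Nat.floor_le (by linarith)
  have hρk : ρ ≤ 2 * k := by
    have := (Nat.lt_floor_add_one ρ).le
    rw [← hKcard, ← hk] at this
    linarith
  have hk0 : 0 < k := by linarith
  have hsk : 0 < √k := Real.sqrt_pos.2 hk0
  set q : ℝ := 1 / (2 * T) with hq
  have hq0 : 0 < q := by positivity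
  have hq1 : q ≤ 1 := by rw [hq, div_le_one (by positivity)]; linarith
  set R := σs * (k * q) ^ (1 - 1 / p) with hR
  have hR0 : 0 < R := by positivity
  set m := min G (R / 8) with hm
  have hm0 : 0 < m := lt_min hG (by positivity)
  have haq : m / (q * √k) * q * √k = m := by field_simp
  -- The scale `a` makes `a q √k` equal to `m`, and `η` puts the minimizers at distance exactly `D`.
  have key := le_minimaxRisk (K := K) (T := T) (a := m / (q * √k)) (q := q) (η := D / √k)
    (D := D) (G := G) hp1 hp2 (by positivity) hq0 hq1 (by rw [hq]; field_simp; rfl) hk1 hσ hl.le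
    (by rwa [← hk, ← le_div_iff₀ (by positivity)])
    (by rw [← hk, haq]; exact min_le_right _ _) (by rw [← hk, haq]; exact min_le_left _ _)
    (by positivity) (by rw [← hk, mul_div_cancel₀ _ hsk.ne'])
  refine (ENNReal.ofReal_le_ofReal ?_).trans key
  have e1 : k * (m / (q * √k) * q) * (D / √k) / 2 = m * D / 2 := by
    have hkk : √k * √k = k := Real.mul_self_sqrt hk0.le
    have : m / (q * √k) * q = m / √k := by field_simp
    rw [this]
    nth_rewrite 1 [← hkk]
    field_simp
  rw [← hk, e1]
  have hrate := rate_le hp1 hp2 hσ hl hT0 hρk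
  rw [← hq, ← hR] at hrate
  set S := σs ^ (2 / p - 1) * σl ^ (2 - 2 / p) / (T : ℝ) ^ (1 - 1 / p) with hS
  have e2 : σs ^ (2 / p - 1) * σl ^ (2 - 2 / p) * D / (T : ℝ) ^ (1 - 1 / p) = S * D := by
    rw [hS]
    ring
  rw [e2, ← min_mul_of_nonneg _ _ hD.le]
  -- `S ≤ 2 R = 16 (R / 8)`. Together with the error bound `m D / 2` this yields the constant
  -- `1/32`.
  have h1 : min G S ≤ 16 * m := by
    rw [hm]
    rcases min_choice G (R / 8) with h | h <;> rw [h]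
    · exact (min_le_left _ _).trans (by linarith)
    · exact (min_le_right _ _).trans (by linarith)
  have h2 := mul_le_mul_of_nonneg_right h1 hD.le
  linarith

end HeavyTailLB

theorem mainTheorem5 :
    ∃ c : ℝ, 0 < c ∧
      ∀ (D G p σs σl : ℝ) (d T : ℕ),
        0 < D → 0 < G → 1 < p → p ≤ 2 → 0 < σs → σs ≤ σl →
        σl ^ 2 / σs ^ 2 ≤ (d : ℝ) → 1 ≤ T →
        ENNReal.ofReal
            (c * min (G * D)
              (σs ^ (2 / p - 1) * σl ^ (2 - 2 / p) * D / (T : ℝ) ^ (1 - 1 / p)))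
          ≤ HeavyTailLB.minimaxRisk d T D G p σs σl :=
  ⟨1 / 32, by norm_num, fun _ _ _ _ _ _ _ hD hG hp1 hp2 hσ hσl hd hT =>
    HeavyTailLB.minimaxRisk_lower_bound hD hG hp1 hp2 hσ hσl hd hT⟩
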